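/- Let $A,\alpha\in\mathbb{R}$. Let $\Gamma$ be the chain graph made of infinitely many rings of circumference $2\pi$, neighbouring rings touching at the vertices $j\pi$, $j\in\mathbb{Z}$. The upper and the lower semicircle of the $j$-th ring are each parametrized by $I_j=(j\pi,(j+1)\pi)$, so that $L^2(\Gamma)=L^2(\mathbb{R})\oplus L^2(\mathbb{R})$; write $\psi_j$ and $\varphi_j$ for the components of a function on the upper and the lower semicircle of the $j$-th ring. Let $\mathcal{D}=\frac{d}{dx}+iA$ on the upper and $\mathcal{D}=\frac{d}{dx}-iA$ on the lower semicircles. For a real sequence $\boldsymbol\beta=(\beta_j)_{j\in\mathbb{Z}}$ let $-\Delta_{\boldsymbol\beta}$ be the operator in $L^2(\Gamma)$ that acts as $-\mathcal{D}^2$ on each edge, on the domain of all functions in $L^2(\Gamma)$ that are in $H^2$ on each edge, are mapped into $L^2(\Gamma)$ by $-\mathcal{D}^2$, and satisfy for all $j\in\mathbb{Z}$ $$\psi_j(j\pi)=\varphi_j(j\pi)=\psi_{j-1}(j\pi)=\varphi_{j-1}(j\pi),$$ $$\mathcal{D}\psi_j(j\pi)+\mathcal{D}\varphi_j(j\pi)-\mathcal{D}\psi_{j-1}(j\pi)-\mathcal{D}\varphi_{j-1}(j\pi)=\beta_j\,\psi_j(j\pi).$$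 Write $-\Delta_\alpha$ for this operator with $\beta_j=\alpha$ for all $j$. Let $m\ge 1$ be an integer, let $\gamma_1,\dots,\gamma_m\in\mathbb{R}$, and write $-\Delta_{\alpha+\gamma}$ for this operator with $\beta_j=\alpha+\gamma_j$ for $1\le j\le m$ and $\beta_j=\alpha$ for all other $j$. Theorem. The essential spectrum of $-\Delta_{\alpha+\gamma}$ coincides with the essential spectrum of $-\Delta_\alpha$. If, moreover, $\gamma_1=\dots=\gamma_m<0$, then $-\Delta_{\alpha+\gamma}$ has at least one eigenvalue below the first spectral band of $-\Delta_\alpha$; that is, the spectrum of $-\Delta_\alpha$ has a smallest element $b$ (the lower edge of its first band), and $-\Delta_{\alpha+\gamma}$ has a real eigenvalue $E<b$. -/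

import Mathlib

open MeasureTheory

namespace RingChain

noncomputable section

/-! ### Spectral notions for an unbounded operator -/

section Spectral

variable {H : Type*} [NormedAddCommGroup H] [InnerProductSpace ℂ H]

/-- `T - z`, as a linear map from the domain of `T` to the Hilbert space. -/
def shift (T : H →ₗ.[ℂ] H) (z : ℂ) : T.domain →ₗ[ℂ] H :=
  T.toFun - z • T.domain.subtype

/-- `z` is in the resolvent set: `T - z` has an everywhere defined bounded inverse. -/
def IsResolventPoint (T : H →ₗ.[ℂ] H) (z : ℂ) : Prop :=
  ∃ R : H →L[ℂ] H,
    (∀ x : T.domain, R (shift T z x) = (x : H)) ∧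
    ∀ y : H, ∃ h : R y ∈ T.domain, shift T z ⟨R y, h⟩ = y

/-- The spectrum of an unbounded operator. -/
def spectrum (T : H →ₗ.[ℂ] H) : Set ℂ := {z | ¬ IsResolventPoint T z}

/-- `z` is an eigenvalue of `T`. -/
def IsEigenvalue (T : H →ₗ.[ℂ] H) (z : ℂ) : Prop :=
  ∃ x : T.domain, (x : H) ≠ 0 ∧ T x = z • (x : H)

/-- `T - z` is a Fredholm operator: finite-dimensional kernel, closed range of finite
codimension. -/
structure IsFredholmAt (T : H →ₗ.[ℂ] H) (z : ℂ) : Prop where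
  finiteDimensional_ker : FiniteDimensional ℂ (LinearMap.ker (shift T z))
  isClosed_range : IsClosed (LinearMap.range (shift T z) : Set H)
  finiteDimensional_coker : FiniteDimensional ℂ (H ⧸ LinearMap.range (shift T z))

/-- The essential spectrum: the points `z` such that `T - z` is not Fredholm. For a self-adjoint
operator this is the spectrum without the isolated eigenvalues of finite multiplicity. -/
def essSpectrum (T : H →ₗ.[ℂ] H) : Set ℂ := {z | ¬ IsFredholmAt T z}

end Spectral

/-! ### The chain of rings

Upper (`true`) and lower (`false`) semicircles of all rings are parametrized by two copies of `ℝ`;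
the `j`-th ring corresponds to the interval `(jπ, (j+1)π)` in both copies, and the vertices are
the points `jπ`. -/

/-- `L²(Γ)`. -/
abbrev L2Chain : Type := PiLp 2 (fun _ : Bool => Lp ℂ 2 (volume : Measure ℝ))

/-- The open interval `(jπ, (j+1)π)` that carries the `j`-th ring. -/
def edge (j : ℤ) : Set ℝ := Set.Ioo (j * Real.pi) ((j + 1) * Real.pi)

/-- `u` is in the Sobolev space `H²(a, b)` with first and second derivatives `v` and `w`:
`u` and `v` are absolutely continuous on `[a, b]` with derivatives `v` and `w`, respectively, and
`w` is square integrable. -/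
structure HasSobolevDerivs (a b : ℝ) (u v w : ℝ → ℂ) : Prop where
  memLp : MemLp w 2 (volume.restrict (Set.Ioo a b))
  deriv_eq : ∀ x ∈ Set.Icc a b, v x = v a + ∫ t in a..x, w t
  self_eq : ∀ x ∈ Set.Icc a b, u x = u a + ∫ t in a..x, v t

/-- The coefficient in the quasiderivative `𝒟 = d/dx ± iA`: the vector potential is `-A` on the
upper semicircles and `A` on the lower ones. -/
def coeff (A : ℝ) (s : Bool) : ℂ := if s then Complex.I * A else -(Complex.I * A)

/-- The quasiderivative `u' + c u` of a function `u` with derivative `v`. -/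
def quasiDeriv (c : ℂ) (u v : ℝ → ℂ) (x : ℝ) : ℂ := v x + c * u x

/-- `ψ` belongs to the domain of the magnetic Laplacian with `δ`-couplings of strengths `α j` at the
vertices `jπ`, and `η = -𝒟²ψ`. The functions `u s j`, `v s j`, `w s j` are the representative
of `ψ` on the edge `(s, j)` and its first two derivatives. -/
structure IsWaveFunction (A : ℝ) (α : ℤ → ℝ) (ψ η : L2Chain) (u v w : Bool → ℤ → ℝ → ℂ) :
    Prop where
  sobolev : ∀ (s : Bool) (j : ℤ), HasSobolevDerivs (j * Real.pi) ((j + 1) * Real.pi) (u s j) (v s j) (w s j)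
  ae_eq : ∀ s j, ∀ᵐ x ∂(volume.restrict (edge j)), (ψ s : ℝ → ℂ) x = u s j x
  action : ∀ s j, ∀ᵐ x ∂(volume.restrict (edge j)), (η s : ℝ → ℂ) x =
    -quasiDeriv (coeff A s) (quasiDeriv (coeff A s) (u s j) (v s j))
      (quasiDeriv (coeff A s) (v s j) (w s j)) x
  cont_lower : ∀ j : ℤ, u false j (j * Real.pi) = u true j (j * Real.pi)
  cont_left : ∀ (s : Bool) (j : ℤ), u s (j - 1) (j * Real.pi) = u true j (j * Real.pi)
  delta : ∀ j : ℤ,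
    quasiDeriv (coeff A true) (u true j) (v true j) (j * Real.pi)
      + quasiDeriv (coeff A false) (u false j) (v false j) (j * Real.pi)
      - quasiDeriv (coeff A true) (u true (j - 1)) (v true (j - 1)) (j * Real.pi)
      - quasiDeriv (coeff A false) (u false (j - 1)) (v false (j - 1)) (j * Real.pi)
      = α j * u true j (j * Real.pi)

theorem HasSobolevDerivs.intervalIntegrable {a b : ℝ} {u v w : ℝ → ℂ}
    (h : HasSobolevDerivs a b u v w) {x : ℝ} (hx : x ∈ Set.Icc a b) :
    IntervalIntegrable w volume a x ∧ IntervalIntegrable v volume a x := by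
  have hab : a ≤ b := hx.1.trans hx.2
  have hw : IntegrableOn w (Set.Icc a b) := by
    rw [integrableOn_Icc_iff_integrableOn_Ioo]
    exact h.memLp.integrable (by norm_num)
  have hc : ContinuousOn v (Set.Icc a b) :=
    (continuousOn_const.add (by
      simpa only [Set.uIcc_of_le hab] using intervalIntegral.continuousOn_primitive_interval
        (a := a) (b := b) (by rwa [Set.uIcc_of_le hab]))).congr h.deriv_eq
  have hs : Set.Icc a x ⊆ Set.Icc a b := Set.Icc_subset_Icc_right hx.2
  refine ⟨?_, ?_⟩
  · rw [intervalIntegrable_iff_integrableOn_Icc_of_le hx.1]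
    exact hw.mono_set hs
  · apply ContinuousOn.intervalIntegrable
    rw [Set.uIcc_of_le hx.1]
    exact hc.mono hs

theorem HasSobolevDerivs.add {a b : ℝ} {u v w u' v' w' : ℝ → ℂ}
    (h : HasSobolevDerivs a b u v w) (h' : HasSobolevDerivs a b u' v' w') :
    HasSobolevDerivs a b (u + u') (v + v') (w + w') where
  memLp := h.memLp.add h'.memLp
  deriv_eq x hx := by
    simp only [Pi.add_apply]
    rw [intervalIntegral.integral_add (h.intervalIntegrable hx).1 (h'.intervalIntegrable hx).1,
      h.deriv_eq x hx, h'.deriv_eq x hx]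
    ring
  self_eq x hx := by
    simp only [Pi.add_apply]
    rw [intervalIntegral.integral_add (h.intervalIntegrable hx).2 (h'.intervalIntegrable hx).2,
      h.self_eq x hx, h'.self_eq x hx]
    ring

theorem HasSobolevDerivs.smul {a b : ℝ} {u v w : ℝ → ℂ} (c : ℂ)
    (h : HasSobolevDerivs a b u v w) : HasSobolevDerivs a b (c • u) (c • v) (c • w) where
  memLp := h.memLp.const_smul c
  deriv_eq x hx := by
    simp only [Pi.smul_apply, intervalIntegral.integral_smul, h.deriv_eq x hx, smul_add]
  self_eq x hx := by
    simp only [Pi.smul_apply, intervalIntegral.integral_smul, h.self_eq x hx, smul_add]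

/-- The graph of the magnetic Laplacian. -/
def hamiltonianGraph (A : ℝ) (α : ℤ → ℝ) : Submodule ℂ (L2Chain × L2Chain) where
  carrier := {p | ∃ u v w, IsWaveFunction A α p.1 p.2 u v w}
  zero_mem' := by
    refine ⟨0, 0, 0, ⟨fun s j => ⟨MemLp.zero, by simp, by simp⟩, fun s j => ?_, fun s j => ?_,
      by simp, by simp, by simp [quasiDeriv]⟩⟩
    · exact Filter.Eventually.of_forall fun x => by simp
    · exact Filter.Eventually.of_forall fun x => by simp [quasiDeriv]
  add_mem' := by
    rintro p q ⟨u, v, w, h⟩ ⟨u', v', w', h'⟩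
    refine ⟨u + u', v + v', w + w', ⟨fun s j => (h.sobolev s j).add (h'.sobolev s j),
      fun s j => ?_, fun s j => ?_, fun j => ?_, fun s j => ?_, fun j => ?_⟩⟩
    · filter_upwards [h.ae_eq s j, h'.ae_eq s j,
        ae_restrict_of_ae (Lp.coeFn_add (p.1 s) (q.1 s))] with x h1 h2 h3
      simpa [h1, h2] using h3
    · filter_upwards [h.action s j, h'.action s j,
        ae_restrict_of_ae (Lp.coeFn_add (p.2 s) (q.2 s))] with x h1 h2 h3
      rw [Prod.snd_add, PiLp.add_apply, h3, Pi.add_apply, h1, h2]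
      simp only [quasiDeriv, Pi.add_apply]
      ring
    · simp only [Pi.add_apply, h.cont_lower, h'.cont_lower]
    · simp only [Pi.add_apply, h.cont_left, h'.cont_left]
    · have h1 := h.delta j
      have h2 := h'.delta j
      simp only [quasiDeriv, Pi.add_apply] at h1 h2 ⊢
      linear_combination h1 + h2
  smul_mem' := by
    rintro c p ⟨u, v, w, h⟩
    refine ⟨c • u, c • v, c • w, ⟨fun s j => (h.sobolev s j).smul c,
      fun s j => ?_, fun s j => ?_, fun j => ?_, fun s j => ?_, fun j => ?_⟩⟩
    · filter_upwards [h.ae_eq s j,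
        ae_restrict_of_ae (Lp.coeFn_smul c (p.1 s))] with x h1 h3
      simpa [h1] using h3
    · filter_upwards [h.action s j,
        ae_restrict_of_ae (Lp.coeFn_smul c (p.2 s))] with x h1 h3
      rw [Prod.smul_snd, PiLp.smul_apply, h3, Pi.smul_apply, h1]
      simp only [quasiDeriv, Pi.smul_apply, smul_eq_mul]
      ring
    · simp only [Pi.smul_apply, h.cont_lower]
    · simp only [Pi.smul_apply, h.cont_left]
    · have h1 := h.delta j
      simp only [quasiDeriv, Pi.smul_apply, smul_eq_mul] at h1 ⊢
      linear_combination c * h1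

theorem HasSobolevDerivs.continuousOn {a b : ℝ} (hab : a ≤ b) {u v w : ℝ → ℂ}
    (h : HasSobolevDerivs a b u v w) : ContinuousOn u (Set.Icc a b) := by
  have hv := (h.intervalIntegrable (Set.right_mem_Icc.2 hab)).2
  rw [intervalIntegrable_iff_integrableOn_Icc_of_le hab] at hv
  exact (continuousOn_const.add (by
    simpa only [Set.uIcc_of_le hab] using intervalIntegral.continuousOn_primitive_interval
      (a := a) (b := b) (by rwa [Set.uIcc_of_le hab]))).congr h.self_eq

theorem HasSobolevDerivs.continuousOn_deriv {a b : ℝ} (hab : a ≤ b) {u v w : ℝ → ℂ}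
    (h : HasSobolevDerivs a b u v w) : ContinuousOn v (Set.Icc a b) := by
  have hw := (h.intervalIntegrable (Set.right_mem_Icc.2 hab)).1
  rw [intervalIntegrable_iff_integrableOn_Icc_of_le hab] at hw
  exact (continuousOn_const.add (by
    simpa only [Set.uIcc_of_le hab] using intervalIntegral.continuousOn_primitive_interval
      (a := a) (b := b) (by rwa [Set.uIcc_of_le hab]))).congr h.deriv_eq

/-- If the primitive of `f` vanishes on `[a, b]`, then so does `f`, almost everywhere. -/
theorem ae_zero_of_primitive_zero {a b : ℝ} (hab : a ≤ b) {f : ℝ → ℂ}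
    (hf : IntervalIntegrable f volume a b)
    (h : ∀ x ∈ Set.Icc a b, ∫ t in a..x, f t = 0) :
    ∀ᵐ x ∂(volume.restrict (Set.Ioo a b)), f x = 0 := by
  rw [ae_restrict_iff' measurableSet_Ioo]
  filter_upwards [hf.ae_hasDerivAt_integral] with x hx hxab
  have h1 := hx (by rw [Set.uIcc_of_le hab]; exact Set.Ioo_subset_Icc_self hxab) a
    Set.left_mem_uIcc
  have h2 : HasDerivAt (fun y => ∫ t in a..y, f t) 0 x := by
    refine (hasDerivAt_const x (0 : ℂ)).congr_of_eventuallyEq ?_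
    filter_upwards [isOpen_Ioo.mem_nhds hxab] with y hy
    exact h y (Set.Ioo_subset_Icc_self hy)
  exact h1.unique h2

/-- The derivatives of a function that vanishes almost everywhere vanish almost everywhere. -/
theorem HasSobolevDerivs.eq_zero {a b : ℝ} (hab : a < b) {u v w : ℝ → ℂ}
    (h : HasSobolevDerivs a b u v w) (hu : ∀ᵐ x ∂(volume.restrict (Set.Ioo a b)), u x = 0) :
    ∀ᵐ x ∂(volume.restrict (Set.Ioo a b)), u x = 0 ∧ v x = 0 ∧ w x = 0 := by
  have hint := h.intervalIntegrable (Set.right_mem_Icc.2 hab.le)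
  have hu0 : Set.EqOn u 0 (Set.Icc a b) := by
    refine Measure.eqOn_Icc_of_ae_eq volume hab.ne ?_ (h.continuousOn hab.le) continuousOn_const
    rw [← restrict_Ioo_eq_restrict_Icc]
    exact hu
  have hv : ∀ᵐ x ∂(volume.restrict (Set.Ioo a b)), v x = 0 := by
    refine ae_zero_of_primitive_zero hab.le hint.2 fun x hx => ?_
    have := h.self_eq x hx
    rw [hu0 hx, hu0 (Set.left_mem_Icc.2 hab.le)] at this
    simpa using this.symm
  have hv0 : Set.EqOn v 0 (Set.Icc a b) := by
    refine Measure.eqOn_Icc_of_ae_eq volume hab.ne ?_ (h.continuousOn_deriv hab.le)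
      continuousOn_const
    rw [← restrict_Ioo_eq_restrict_Icc]
    exact hv
  have hw : ∀ᵐ x ∂(volume.restrict (Set.Ioo a b)), w x = 0 := by
    refine ae_zero_of_primitive_zero hab.le hint.1 fun x hx => ?_
    have := h.deriv_eq x hx
    rw [hv0 hx, hv0 (Set.left_mem_Icc.2 hab.le)] at this
    simpa using this.symm
  filter_upwards [hu, hv, hw] with x h1 h2 h3 using ⟨h1, h2, h3⟩

/-- Almost every real number lies on some edge. -/
theorem ae_of_ae_edge {p : ℝ → Prop} (h : ∀ j, ∀ᵐ x ∂(volume.restrict (edge j)), p x) :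
    ∀ᵐ x ∂(volume : Measure ℝ), p x := by
  have h1 : ∀ᵐ x ∂(volume : Measure ℝ), ∀ j : ℤ, x ≠ j * Real.pi := by
    rw [ae_all_iff]
    intro j
    exact Measure.ae_ne volume _
  have h2 : ∀ᵐ x ∂(volume : Measure ℝ), ∀ j : ℤ, x ∈ edge j → p x := by
    rw [ae_all_iff]
    intro j
    exact (ae_restrict_iff' measurableSet_Ioo).1 (h j)
  filter_upwards [h1, h2] with x hx1 hx2
  have hpi := Real.pi_pos
  refine hx2 ⌊x / Real.pi⌋ ⟨lt_of_le_of_ne ?_ (hx1 _).symm, ?_⟩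
  · exact (le_div_iff₀ hpi).1 (Int.floor_le _)
  · exact (div_lt_iff₀ hpi).1 (Int.lt_floor_add_one _)

/-- The graph is single-valued, so that it is indeed the graph of a linear operator. -/
theorem hamiltonianGraph_functional (A : ℝ) (α : ℤ → ℝ) :
    ∀ p ∈ hamiltonianGraph A α, p.1 = 0 → p.2 = 0 := by
  rintro p ⟨u, v, w, h⟩ hp
  ext s
  refine ae_of_ae_edge fun j => ?_
  have hab : (j : ℝ) * Real.pi < (j + 1) * Real.pi := by
    nlinarith [Real.pi_pos]
  have hu : ∀ᵐ x ∂(volume.restrict (edge j)), u s j x = 0 := by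
    filter_upwards [h.ae_eq s j,
      ae_restrict_of_ae (Lp.coeFn_zero ℂ 2 (volume : Measure ℝ))] with x h1 h2
    rw [← h1, hp]
    exact h2
  filter_upwards [(h.sobolev s j).eq_zero hab hu, h.action s j,
    ae_restrict_of_ae (Lp.coeFn_zero ℂ 2 (volume : Measure ℝ))] with x h1 h2 h3
  refine h2.trans (Eq.trans ?_ h3.symm)
  simp [quasiDeriv, h1.1, h1.2.1, h1.2.2]

/-- The magnetic Laplacian on the chain graph with `δ`-couplings `α j`, as an unbounded operator
in `L²(Γ)`. -/
def hamiltonian (A : ℝ) (α : ℤ → ℝ) : L2Chain →ₗ.[ℂ] L2Chain :=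
  (hamiltonianGraph A α).toLinearPMap

theorem hamiltonian_graph (A : ℝ) (α : ℤ → ℝ) :
    (hamiltonian A α).graph = hamiltonianGraph A α :=
  Submodule.toLinearPMap_graph_eq _ (hamiltonianGraph_functional A α)

/-- The constant coupling `α`, changed by `γ j` at the vertices `j = 1, …, m`. -/
def perturbedCoupling (α : ℝ) (m : ℕ) (γ : ℤ → ℝ) (j : ℤ) : ℝ :=
  if 1 ≤ j ∧ j ≤ m then α + γ j else α

end

end RingChain

/-! For energies `E < 1`, that is, below the first Dirichlet eigenvalue of a semicircle, a function
on the chain is determined by its vertex values `q j` together with its image `f` under `-Δ - E`.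
Eliminating the fluxes turns the δ-conditions into a Jacobi equation `disc (β j) E * q j - c * (q (j
+ 1) + q (j - 1)) = r j` on `ℤ`. Here `c = 2 cos (A π)`, and `r` depends boundedly on `f`. The
passage works in both directions with `ℓ²` control: `IsWaveFunction.jacobi` and `summable_trace`
lead to sequences, `exists_wave` leads back.

Band edge: where the diagonal entries exceed `2 * |c|` uniformly, a Neumann series solves the Jacobi
equation, so `E` is a resolvent point (`isResolventPoint_hamiltonian`). The edge `b` is the first
energy with `disc α b = 2 * |c|`. For `c ≠ 0` the free recursion there has, up to alternating signs,
only affine solutions, none of them nonzero and decaying; hence a suitable source on one ring admits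
no `ℓ²` solution and `b` is in the spectrum (`bandEdge_mem_spectrum`).

Eigenvalue: a bound state decays geometrically to both sides of the vertices `1, …, m`. Its energy
is found by shooting, with induction on the number of attractive vertices: each further vertex
pushes the matching energy strictly down, starting from `b` for none (`exists_jacobiSol_matching`).

Essential spectrum: the two operators coincide on functions vanishing at the vertices `1, …, m`. The
vertex values are linear functionals on pairs (function, image), so the graphs agree up to finitely
many linear constraints, which affect neither finiteness of the kernel nor that of the cokernel.
Closedness of the range then comes for free, since the range of `T - z` is that of a bounded
operator built from a resolvent (`IsFredholmAt.of_agree_on_ker`). -/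

namespace RingChain

noncomputable section

/-! ### Fundamental system of `y'' = -E y` -/

/-- The solution of `y'' = -E y` with `y 0 = 1`, `y' 0 = 0`. -/
def cosE (E t : ℝ) : ℝ := Real.cos (√E * t) * Real.cosh (√(-E) * t)

/-- The solution of `y'' = -E y` with `y 0 = 0`, `y' 0 = 1`. -/
def sinE (E t : ℝ) : ℝ :=
  t * dslope Real.sin 0 (√E * t) * dslope Real.sinh 0 (√(-E) * t)

theorem cosE_of_pos {E : ℝ} (hE : 0 < E) (t : ℝ) : cosE E t = Real.cos (√E * t) := by
  simp [cosE, Real.sqrt_eq_zero'.2 (neg_nonpos.2 hE.le)]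

theorem cosE_of_neg {E : ℝ} (hE : E < 0) (t : ℝ) : cosE E t = Real.cosh (√(-E) * t) := by
  simp [cosE, Real.sqrt_eq_zero'.2 hE.le]

theorem dslope_sin_mul (x : ℝ) : x * dslope Real.sin 0 x = Real.sin x := by
  have := sub_smul_dslope Real.sin 0 x
  simpa using this

theorem dslope_sinh_mul (x : ℝ) : x * dslope Real.sinh 0 x = Real.sinh x := by
  have := sub_smul_dslope Real.sinh 0 x
  simpa using this

theorem sinE_of_pos {E : ℝ} (hE : 0 < E) (t : ℝ) : sinE E t = Real.sin (√E * t) / √E := by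
  have h := Real.sqrt_pos.2 hE
  rw [← dslope_sin_mul (√E * t)]
  simp only [sinE, Real.sqrt_eq_zero'.2 (neg_nonpos.2 hE.le), zero_mul, dslope_same, Real.deriv_sinh,
    Real.cosh_zero]
  field_simp

theorem sinE_of_neg {E : ℝ} (hE : E < 0) (t : ℝ) :
    sinE E t = Real.sinh (√(-E) * t) / √(-E) := by
  have h := Real.sqrt_pos.2 (neg_pos.2 hE)
  rw [← dslope_sinh_mul (√(-E) * t)]
  simp only [sinE, Real.sqrt_eq_zero'.2 hE.le, zero_mul, dslope_same, Real.deriv_sin, Real.cos_zero]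
  field_simp

theorem cosE_energy_zero (t : ℝ) : cosE 0 t = 1 := by simp [cosE]

theorem sinE_energy_zero (t : ℝ) : sinE 0 t = t := by simp [sinE, dslope_same]

@[simp] theorem cosE_zero (E : ℝ) : cosE E 0 = 1 := by simp [cosE]

@[simp] theorem sinE_zero (E : ℝ) : sinE E 0 = 0 := by simp [sinE]

theorem hasDerivAt_cosE (E t : ℝ) : HasDerivAt (cosE E) (-E * sinE E t) t := by
  rcases lt_trichotomy E 0 with hE | rfl | hE
  · have hs := Real.sqrt_pos.2 (neg_pos.2 hE)
    have hsq := Real.mul_self_sqrt (neg_pos.2 hE).le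
    rw [funext (cosE_of_neg hE), sinE_of_neg hE]
    convert! ((hasDerivAt_id t).const_mul √(-E)).cosh using 1
    rw [← hsq]; simp; field_simp
  · simpa [funext cosE_energy_zero] using hasDerivAt_const t (1 : ℝ)
  · have hs := Real.sqrt_pos.2 hE
    have hsq := Real.mul_self_sqrt hE.le
    rw [funext (cosE_of_pos hE), sinE_of_pos hE]
    convert! ((hasDerivAt_id t).const_mul √E).cos using 1
    nth_rw 1 [← hsq]; simp; field_simp

theorem hasDerivAt_sinE (E t : ℝ) : HasDerivAt (sinE E) (cosE E t) t := by
  rcases lt_trichotomy E 0 with hE | rfl | hE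
  · have hs := Real.sqrt_pos.2 (neg_pos.2 hE)
    rw [funext (sinE_of_neg hE), cosE_of_neg hE]
    convert! ((hasDerivAt_id t).const_mul √(-E)).sinh.div_const √(-E) using 1
    simp; field_simp
  · simpa [funext sinE_energy_zero, cosE_energy_zero] using hasDerivAt_id' t
  · have hs := Real.sqrt_pos.2 hE
    rw [funext (sinE_of_pos hE), cosE_of_pos hE]
    convert! ((hasDerivAt_id t).const_mul √E).sin.div_const √E using 1
    simp; field_simp

/-- The left side is the Wronskian of the fundamental system, hence constant in `t`. It enters the
variation of constants in `exists_edge_solution`. -/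
theorem cosE_sq_add (E t : ℝ) : cosE E t ^ 2 + E * sinE E t ^ 2 = 1 := by
  have h : ∀ s, HasDerivAt (fun s => cosE E s ^ 2 + E * sinE E s ^ 2) 0 s := fun s => by
    convert! ((hasDerivAt_cosE E s).pow 2).add (((hasDerivAt_sinE E s).pow 2).const_mul E) using 1
    simp; ring
  have := is_const_of_deriv_eq_zero (fun s => (h s).differentiableAt) (fun s => (h s).deriv) t 0
  simpa using this

theorem continuous_cosE (E : ℝ) : Continuous (cosE E) :=
  continuous_iff_continuousAt.2 fun t => (hasDerivAt_cosE E t).continuousAt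

theorem continuous_sinE (E : ℝ) : Continuous (sinE E) :=
  continuous_iff_continuousAt.2 fun t => (hasDerivAt_sinE E t).continuousAt

theorem continuous_dslope_zero {f : ℝ → ℝ} (hf : Differentiable ℝ f) :
    Continuous (dslope f 0) := by
  rw [continuous_iff_continuousAt]
  intro x
  rcases eq_or_ne x 0 with rfl | hx
  · exact continuousAt_dslope_same.2 (hf 0)
  · exact (continuousAt_dslope_of_ne hx).2 (hf x).continuousAt

theorem continuous_cosE_energy (t : ℝ) : Continuous fun E => cosE E t := by
  unfold cosE
  have := Real.continuous_cosh
  fun_prop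

/-- This is the reason for the product form of `sinE`: the square root of a negative number is `0`,
so at least one `dslope` factor is always `1`, and the other stays continuous across `E = 0`, where
`sin (√E t) / √E` would be a division by zero. -/
theorem continuous_sinE_energy (t : ℝ) : Continuous fun E => sinE E t := by
  unfold sinE
  have h1 := continuous_dslope_zero Real.differentiable_sin
  have h2 := continuous_dslope_zero Real.differentiable_sinh
  fun_prop

/-- A zero in `(0, π]` would make `E` a Dirichlet eigenvalue of an interval of length at most `π`,
and the smallest such value is `1`. -/
theorem sinE_pos {E t : ℝ} (hE : E < 1) (ht : 0 < t) (ht' : t ≤ Real.pi) : 0 < sinE E t := by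
  rcases lt_trichotomy E 0 with h | rfl | h
  · have hs := Real.sqrt_pos.2 (neg_pos.2 h)
    rw [sinE_of_neg h]
    exact div_pos (Real.sinh_pos_iff.2 (by positivity)) hs
  · rwa [sinE_energy_zero]
  · have hs := Real.sqrt_pos.2 h
    rw [sinE_of_pos h]
    refine div_pos (Real.sin_pos_of_pos_of_lt_pi (by positivity) ?_) hs
    have : √E < 1 := by rwa [Real.sqrt_lt' one_pos, one_pow]
    nlinarith

theorem sinE_pi_pos {E : ℝ} (hE : E < 1) : 0 < sinE E Real.pi := sinE_pos hE Real.pi_pos le_rfl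

/-! ### The discriminant -/

/-- The diagonal entry of the Jacobi matrix that belongs to energy `E` and coupling `β`. -/
def disc (β E : ℝ) : ℝ := 4 * cosE E Real.pi + β * sinE E Real.pi

theorem continuous_disc (β : ℝ) : Continuous (disc β) :=
  ((continuous_cosE_energy _).const_mul 4).add ((continuous_sinE_energy _).const_mul β)

/-- At the Dirichlet eigenvalue the coupling drops out. The negative value forces every level `d ≥
0` to be reached before `E = 1`. -/
theorem disc_one (β : ℝ) : disc β 1 = -4 := by
  simp [disc, cosE_of_pos, sinE_of_pos]

theorem disc_add (β γ E : ℝ) : disc (β + γ) E = disc β E + γ * sinE E Real.pi := by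
  simp only [disc]; ring

theorem disc_mono {β γ E : ℝ} (hE : E < 1) (h : β ≤ γ) : disc β E ≤ disc γ E := by
  have := mul_le_mul_of_nonneg_right h (sinE_pi_pos hE).le
  simp only [disc]; linarith

/-- With `k = √(-E) ≥ |β|`, the coupling term costs at most one of the four `cosh (k π)`, and the
remaining three are at least `6`. What matters about `5` is that it exceeds `4`, the largest
possible value of `2 * |c|`. -/
theorem exists_le_disc (β : ℝ) : ∃ E₀ < 0, ∀ E ≤ E₀, 5 ≤ disc β E := by
  have hM : 0 < max 1 |β| := lt_max_of_lt_left one_pos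
  refine ⟨-(max 1 |β|) ^ 2, by nlinarith, fun E hE => ?_⟩
  have hE0 : E < 0 := by nlinarith
  set k := √(-E) with hk
  have hk1 : max 1 |β| ≤ k := Real.le_sqrt_of_sq_le (by linarith)
  have h1 : 1 ≤ k := (le_max_left _ _).trans hk1
  have h2 : |β| ≤ k := (le_max_right _ _).trans hk1
  have hx : 3 ≤ k * Real.pi := by nlinarith [Real.pi_gt_three]
  have hc : 2 ≤ Real.cosh (k * Real.pi) := by
    rw [Real.cosh_eq]
    have := Real.add_one_le_exp (k * Real.pi)
    have := Real.exp_pos (-(k * Real.pi))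
    linarith
  have hs : 0 ≤ Real.sinh (k * Real.pi) := Real.sinh_nonneg_iff.2 (by linarith)
  have hsc : Real.sinh (k * Real.pi) ≤ Real.cosh (k * Real.pi) := (Real.sinh_lt_cosh _).le
  have h3 : -Real.cosh (k * Real.pi) ≤ β * (Real.sinh (k * Real.pi) / k) := by
    have h4 : |β| * (Real.sinh (k * Real.pi) / k) ≤ Real.sinh (k * Real.pi) := by
      rw [mul_div_assoc', div_le_iff₀ (by linarith)]
      nlinarith
    have h5 : 0 ≤ Real.sinh (k * Real.pi) / k := by positivity
    nlinarith [neg_abs_le β]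
  rw [disc, cosE_of_neg hE0, sinE_of_neg hE0, ← hk]
  linarith

/-- The lower edge of the first band. -/
theorem exists_bandEdge (α : ℝ) {d : ℝ} (hd : 0 ≤ d) (hd' : d < 5) :
    ∃ b < 1, disc α b = d ∧ ∀ E < b, d < disc α E := by
  obtain ⟨E₀, hE₀, h⟩ := exists_le_disc α
  -- The infimum of the sublevel set is the first crossing of the level `d`; no monotonicity of
  -- `disc` is needed.
  let K : Set ℝ := {E | disc α E ≤ d}
  have hK : IsClosed K := isClosed_le (continuous_disc α) continuous_const
  have h1 : (1 : ℝ) ∈ K := by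
    change disc α 1 ≤ d
    rw [disc_one]; linarith
  have hb : BddBelow K := ⟨E₀, fun E hE => by
    by_contra! hlt
    have : disc α E ≤ d := hE
    linarith [h E hlt.le]⟩
  have hmem : sInf K ∈ K := hK.csInf_mem ⟨1, h1⟩ hb
  have hlt : ∀ E < sInf K, d < disc α E := fun E hE => by
    by_contra! hle
    exact absurd (csInf_le hb hle) (not_le.2 hE)
  have heq : disc α (sInf K) = d := by
    refine le_antisymm hmem ?_
    refine ge_of_tendsto ((continuous_disc α).continuousWithinAt (s := Set.Iio (sInf K))) ?_
    exact Filter.eventually_of_mem self_mem_nhdsWithin fun E hE => (hlt E hE).le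
  refine ⟨sInf K, lt_of_le_of_ne (csInf_le hb h1) fun h => ?_, heq, hlt⟩
  rw [h, disc_one] at heq
  linarith


/-! ### Bound states of the Jacobi matrix -/

/-- The decaying solution of `c (x + x⁻¹) = D`. -/
def decayRate (c D : ℝ) : ℝ := (D - √(D ^ 2 - 4 * c ^ 2)) / (2 * c)

theorem decayRate_eq {c D : ℝ} (hc : 0 < c) (hD : 2 * c ≤ D) :
    c * (1 + decayRate c D ^ 2) = D * decayRate c D := by
  have h := Real.sq_sqrt (show 0 ≤ D ^ 2 - 4 * c ^ 2 by nlinarith)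
  rw [decayRate]
  set s := √(D ^ 2 - 4 * c ^ 2)
  field_simp
  linear_combination h

theorem decayRate_pos {c D : ℝ} (hc : 0 < c) (hD : 2 * c ≤ D) : 0 < decayRate c D := by
  refine div_pos (sub_pos.2 ?_) (by linarith)
  rw [Real.sqrt_lt' (by linarith)]
  nlinarith [pow_pos hc 2]

theorem decayRate_lt_one {c D : ℝ} (hc : 0 < c) (hD : 2 * c < D) : decayRate c D < 1 := by
  rw [decayRate, div_lt_one (by linarith), sub_lt_comm]
  refine Real.lt_sqrt_of_sq_lt ?_
  nlinarith

theorem continuous_decayRate (c : ℝ) : Continuous (decayRate c) := by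
  unfold decayRate
  fun_prop

/-- The solution of the Jacobi recursion with coefficient `a` and initial values `x`, `1`. -/
def jacobiSol (a x : ℝ) : ℕ → ℝ
  | 0 => x
  | 1 => 1
  | n + 2 => a * jacobiSol a x (n + 1) - jacobiSol a x n

theorem continuous_jacobiSol {a x : ℝ → ℝ} (ha : Continuous a) (hx : Continuous x) (n : ℕ) :
    Continuous fun E => jacobiSol (a E) (x E) n := by
  induction n using Nat.twoStepInduction with
  | zero => simpa [jacobiSol] using hx
  | one => simpa [jacobiSol] using continuous_const
  | more n h1 h2 => exact (ha.mul h2).sub h1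

/-- A positive solution has nonnegative second difference when `a ≥ 2`; it increases from `x` to `1`
and therefore keeps increasing. -/
theorem jacobiSol_pos_of_two_le {a x : ℝ} (ha : 2 ≤ a) (hx0 : 0 < x) (hx : x < 1) (n : ℕ) :
    0 < jacobiSol a x n ∧ jacobiSol a x n < jacobiSol a x (n + 1) := by
  induction n with
  | zero => simpa [jacobiSol] using ⟨hx0, hx⟩
  | succ n ih =>
    refine ⟨ih.1.trans ih.2, ?_⟩
    rw [show n + 1 + 1 = n + 2 from rfl, jacobiSol]
    nlinarith [ih.1, ih.2]

/-- Shooting from the left: the values `x`, `1` at the sites `0`, `1` continue the tail `x ^ (1 -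
j)`, and the matching condition says that a decaying tail can take over after `k` perturbed sites.
The sign information for all `E ≤ e` is what carries the induction: it keeps the next solution
positive, while at `e` itself one more attractive site bends the solution below the decaying tail,
so the next matching energy is strictly smaller. For `k = 0` the matching occurs at `b`, where `x =
1`. -/
theorem exists_jacobiSol_matching {c α g b : ℝ} (hc : 0 < c) (hc2 : c ≤ 2) (hg : g < 0)
    (hb1 : b < 1) (hb : disc α b = 2 * c) (hlt : ∀ E < b, 2 * c < disc α E) (k : ℕ) :
    ∃ e ≤ b, (k ≠ 0 → e < b) ∧
      jacobiSol (disc (α + g) e / c) (decayRate c (disc α e)) (k + 1) =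
        decayRate c (disc α e) * jacobiSol (disc (α + g) e / c) (decayRate c (disc α e)) k ∧
      ∀ E ≤ e, 0 < jacobiSol (disc (α + g) E / c) (decayRate c (disc α E)) k ∧
        decayRate c (disc α E) * jacobiSol (disc (α + g) E / c) (decayRate c (disc α E)) k ≤
          jacobiSol (disc (α + g) E / c) (decayRate c (disc α E)) (k + 1) := by
  have hle : ∀ E ≤ b, 2 * c ≤ disc α E := fun E hE => by
    rcases hE.lt_or_eq with h | rfl
    · exact (hlt E h).le
    · exact hb.ge
  have hpos : ∀ E ≤ b, 0 < decayRate c (disc α E) := fun E hE => decayRate_pos hc (hle E hE)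
  have hone : ∀ E ≤ b, decayRate c (disc α E) ≤ 1 := fun E hE => by
    rcases hE.lt_or_eq with h | rfl
    · exact (decayRate_lt_one hc (hlt E h)).le
    · rw [hb, decayRate]
      rw [show (2 * c) ^ 2 - 4 * c ^ 2 = 0 by ring, Real.sqrt_zero, sub_zero, div_self (by linarith)]
  induction k with
  | zero =>
    refine ⟨b, le_rfl, by simp, ?_, fun E hE => ⟨hpos E hE, ?_⟩⟩
    · rw [hb, decayRate, show (2 * c) ^ 2 - 4 * c ^ 2 = 0 by ring, Real.sqrt_zero, sub_zero,
        div_self (by linarith)]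
      simp [jacobiSol]
    · have h1 := hpos E hE
      have h2 := hone E hE
      simp only [jacobiSol]
      nlinarith
  | succ k ih =>
    obtain ⟨e, heb, -, he, hE⟩ := ih
    set Q : ℕ → ℝ → ℝ := fun n E => jacobiSol (disc (α + g) E / c) (decayRate c (disc α E)) n
      with hQ
    have hQc : ∀ n, Continuous (Q n) := fun n =>
      continuous_jacobiSol ((continuous_disc _).div_const c)
        ((continuous_decayRate c).comp (continuous_disc α)) n
    let f : ℝ → ℝ := fun E => Q (k + 2) E - decayRate c (disc α E) * Q (k + 1) E
    have hf : Continuous f :=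
      (hQc _).sub (((continuous_decayRate c).comp (continuous_disc α)).mul (hQc _))
    have hfe : f e < 0 := by
      have h1 : Q (k + 1) e = decayRate c (disc α e) * Q k e := he
      have h2 : Q (k + 2) e = disc (α + g) e / c * Q (k + 1) e - Q k e := rfl
      have h3 := decayRate_eq hc (hle e heb)
      -- With the unperturbed coefficient the geometric tail would continue and the mismatch would
      -- vanish; only the contribution of `g` remains.
      have h4 : f e = g * sinE e Real.pi * decayRate c (disc α e) * Q k e / c := by
        simp only [f, h2, h1, disc_add]
        field_simp
        linear_combination (-Q k e) * h3
      rw [h4]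
      refine div_neg_of_neg_of_pos ?_ hc
      have := mul_pos (mul_pos (sinE_pi_pos (heb.trans_lt hb1)) (hpos e heb)) (hE e le_rfl).1
      nlinarith
    let K : Set ℝ := {E | E ≤ e ∧ f E ≤ 0}
    have hK : IsClosed K :=
      (isClosed_le continuous_id continuous_const).inter (isClosed_le hf continuous_const)
    obtain ⟨E₀, -, hE₀⟩ := exists_le_disc (α + g)
    -- Far below, the coefficient is at least `5 / c ≥ 2`, so the solution increases and the
    -- mismatch is positive. The term `b - 1` ensures `E < b`, hence a decay rate below `1`.
    have hbdd : BddBelow K := ⟨min E₀ (b - 1), fun E hE' => by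
      by_contra! hlt'
      have h1 : E < b := by linarith [hlt'.trans_le (min_le_right _ _)]
      have h2 := hE₀ E (hlt'.trans_le (min_le_left _ _)).le
      have h3 : 2 ≤ disc (α + g) E / c := by
        rw [le_div_iff₀ hc]; linarith
      have h4 := jacobiSol_pos_of_two_le h3 (hpos E h1.le) (decayRate_lt_one hc (hlt E h1)) (k + 1)
      have h5 : f E ≤ 0 := hE'.2
      have h6 : Q (k + 1) E < Q (k + 2) E := h4.2
      have h7 : 0 < Q (k + 1) E := h4.1
      have h8 := hone E h1.le
      simp only [f] at h5
      nlinarith⟩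
    have hmem : sInf K ∈ K := hK.csInf_mem ⟨e, le_rfl, hfe.le⟩ hbdd
    have hlow : ∀ E < sInf K, 0 ≤ f E := fun E hE' => by
      by_contra! hneg
      exact absurd (csInf_le hbdd ⟨hE'.le.trans hmem.1, hneg.le⟩) (not_le.2 hE')
    have hge : 0 ≤ f (sInf K) := by
      refine ge_of_tendsto (hf.continuousWithinAt (s := Set.Iio (sInf K))) ?_
      exact Filter.eventually_of_mem self_mem_nhdsWithin hlow
    have hzero : f (sInf K) = 0 := le_antisymm hmem.2 hge
    have hlte : sInf K < e := lt_of_le_of_ne hmem.1 fun h => by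
      rw [h] at hzero; linarith
    refine ⟨sInf K, hmem.1.trans heb, fun _ => hlte.trans_le heb, sub_eq_zero.1 hzero,
      fun E hE' => ⟨?_, ?_⟩⟩
    · have h1 := hE E (hE'.trans hmem.1)
      exact (mul_pos (hpos E ((hE'.trans hmem.1).trans heb)) h1.1).trans_le h1.2
    · refine sub_nonneg.1 (show 0 ≤ f E from ?_)
      rcases hE'.lt_or_eq with h | h
      · exact hlow E h
      · rw [h]; exact hge

/-- The state is glued from the tail `x ^ (1 - j)`, the shooting solution on `1, …, m`, and the tail
`Q m * x ^ (j - m)`. The descriptions overlap (`hA` up to site `1`, `hB` on `0, …, m + 1`, `hC` from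
site `m`), so each three-term relation is checked within a single one. -/
theorem exists_bound_state_of_pos {c α g b : ℝ} (hc : 0 < c) (hc2 : c ≤ 2) (hg : g < 0)
    (hb1 : b < 1) (hb : disc α b = 2 * c) (hlt : ∀ E < b, 2 * c < disc α E) {m : ℕ}
    (hm : 1 ≤ m) :
    ∃ E < b, ∃ q : ℤ → ℝ, (∃ j, q j ≠ 0) ∧ Summable (fun j => q j ^ 2) ∧
      ∀ j : ℤ, disc (if 1 ≤ j ∧ j ≤ m then α + g else α) E * q j = c * (q (j + 1) + q (j - 1)) := by
  obtain ⟨e, -, heb, hmatch, -⟩ := exists_jacobiSol_matching hc hc2 hg hb1 hb hlt m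
  have heb : e < b := heb (by lia)
  set x := decayRate c (disc α e) with hx
  set Q := jacobiSol (disc (α + g) e / c) x with hQ
  have hx0 : 0 < x := decayRate_pos hc (hlt e heb).le
  have hx1 : x < 1 := decayRate_lt_one hc (hlt e heb)
  have hxe := decayRate_eq hc (hlt e heb).le
  rw [← hx] at hxe
  let q : ℤ → ℝ := fun j =>
    if j ≤ 0 then x ^ (1 - j).toNat else if j ≤ m then Q j.toNat else Q m * x ^ (j - m).toNat
  have hA : ∀ n : ℕ, q (1 - n) = x ^ n := fun n => by
    by_cases hn : n = 0
    · subst hn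
      have : (1 : ℤ) ≤ m := by exact_mod_cast hm
      simp [q, this, hQ, jacobiSol]
    · have h1 : (1 : ℤ) - n ≤ 0 := by lia
      simp only [q, if_pos h1]
      congr 1
      lia
  have hC : ∀ n : ℕ, q (m + n) = Q m * x ^ n := fun n => by
    have h1 : ¬ ((m : ℤ) + n ≤ 0) := by lia
    by_cases hn : n = 0
    · subst hn
      simp [q, show m ≠ 0 by lia]
    · have h2 : ¬ ((m : ℤ) + n ≤ m) := by lia
      simp only [q, if_neg h1, if_neg h2]
      congr 2
      lia
  have hB : ∀ n : ℕ, n ≤ m + 1 → q n = Q n := fun n hn => by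
    rcases Nat.eq_zero_or_pos n with rfl | h0
    · have := hA 1
      simpa [hQ, jacobiSol] using this
    · by_cases h1 : n ≤ m
      · have h2 : ¬ ((n : ℤ) ≤ 0) := by lia
        have h3 : (n : ℤ) ≤ m := by lia
        simp only [q, if_neg h2, if_pos h3, Int.toNat_natCast]
      · obtain rfl : n = m + 1 := by lia
        have := hC 1
        -- The overlap at site `m + 1` is exactly the matching condition.
        rw [hmatch]
        push_cast at this ⊢
        rw [this]; ring
  have hx2 : Summable fun n : ℕ => (x ^ 2) ^ n :=
    summable_geometric_of_lt_one (by positivity) (by nlinarith)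
  refine ⟨e, heb, q, ⟨1, ?_⟩, Summable.of_nat_of_neg ?_ ?_, fun j => ?_⟩
  · have := hA 0
    norm_num at this
    rw [this]; exact one_ne_zero
  · rw [← summable_nat_add_iff m]
    refine (hx2.mul_left (Q m ^ 2)).congr fun n => ?_
    rw [show ((n + m : ℕ) : ℤ) = (m : ℤ) + n by push_cast; ring, hC]
    ring
  · refine (hx2.mul_left (x ^ 2)).congr fun n => ?_
    rw [show -(n : ℤ) = 1 - ((n + 1 : ℕ) : ℤ) by push_cast; ring, hA]
    ring
  · rcases le_or_gt j 0 with hj | hj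
    · obtain ⟨n, hn⟩ : ∃ n : ℕ, j = 1 - ((n + 1 : ℕ) : ℤ) := ⟨(-j).toNat, by lia⟩
      rw [if_neg (by lia), hn, show (1 : ℤ) - ((n + 1 : ℕ) : ℤ) + 1 = 1 - (n : ℤ) by push_cast; ring,
        show (1 : ℤ) - ((n + 1 : ℕ) : ℤ) - 1 = 1 - ((n + 2 : ℕ) : ℤ) by push_cast; ring, hA, hA, hA]
      linear_combination (-x ^ n) * hxe
    · rcases le_or_gt j m with hj2 | hj2
      · obtain ⟨n, hn⟩ : ∃ n : ℕ, j = ((n + 1 : ℕ) : ℤ) := ⟨(j - 1).toNat, by lia⟩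
        have hnm : n + 1 ≤ m := by lia
        rw [if_pos ⟨hj, hj2⟩, hn, show ((n + 1 : ℕ) : ℤ) + 1 = ((n + 2 : ℕ) : ℤ) by push_cast; ring,
          show ((n + 1 : ℕ) : ℤ) - 1 = (n : ℤ) by push_cast; ring, hB _ (by lia), hB _ (by lia),
          hB _ (by lia), show Q (n + 2) = disc (α + g) e / c * Q (n + 1) - Q n from rfl]
        field_simp
        ring
      · obtain ⟨n, hn⟩ : ∃ n : ℕ, j = m + ((n + 1 : ℕ) : ℤ) := ⟨(j - m - 1).toNat, by lia⟩
        rw [if_neg (by lia), hn,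
          show (m : ℤ) + ((n + 1 : ℕ) : ℤ) + 1 = m + ((n + 2 : ℕ) : ℤ) by push_cast; ring,
          show (m : ℤ) + ((n + 1 : ℕ) : ℤ) - 1 = m + (n : ℤ) by push_cast; ring, hC, hC, hC]
        linear_combination (-(Q m * x ^ n)) * hxe

/-- Negative `c` reduces to positive `c` by the alternating sign `(-1) ^ j`. For `c = 0` the sites
decouple, and a sequence supported at site `1` works at a zero of `disc (α + g)`, which lies below
`b` because this function is negative at `b` and positive far below. -/
theorem exists_bound_state {c α g b : ℝ} (hc2 : |c| ≤ 2) (hg : g < 0)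
    (hb1 : b < 1) (hb : disc α b = 2 * |c|) (hlt : ∀ E < b, 2 * |c| < disc α E) {m : ℕ}
    (hm : 1 ≤ m) :
    ∃ E < b, ∃ q : ℤ → ℝ, (∃ j, q j ≠ 0) ∧ Summable (fun j => q j ^ 2) ∧
      ∀ j : ℤ, disc (if 1 ≤ j ∧ j ≤ m then α + g else α) E * q j = c * (q (j + 1) + q (j - 1)) := by
  rcases lt_trichotomy c 0 with hc | rfl | hc
  · rw [abs_of_neg hc] at hc2 hb hlt
    obtain ⟨E, hE, q, ⟨j, hj⟩, hq, h⟩ := exists_bound_state_of_pos (neg_pos.2 hc) hc2 hg hb1 hb hlt hm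
    refine ⟨E, hE, fun j => (-1) ^ j * q j, ⟨j, ?_⟩, hq.congr fun j => ?_, fun j => ?_⟩
    · exact mul_ne_zero (zpow_ne_zero _ (by norm_num)) hj
    · have : ((-1 : ℝ) ^ j) ^ 2 = 1 := by rw [← zpow_natCast, zpow_comm]; simp
      rw [mul_pow, this, one_mul]
    · have h1 : ((-1 : ℝ)) ^ (j + 1) = -(-1) ^ j := by
        rw [zpow_add_one₀ (by norm_num)]; ring
      have h2 : ((-1 : ℝ)) ^ (j - 1) = -(-1) ^ j := by
        rw [zpow_sub_one₀ (by norm_num)]; norm_num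
      simp only [h1, h2]
      linear_combination (-1 : ℝ) ^ j * h j
  · simp only [abs_zero, mul_zero] at hb hlt
    have h1 : disc (α + g) b < 0 := by
      rw [disc_add, hb]
      nlinarith [sinE_pi_pos hb1]
    obtain ⟨E₀, -, hE₀⟩ := exists_le_disc (α + g)
    have h2 : min E₀ b ≤ b := min_le_right _ _
    have h3 := intermediate_value_Icc' h2 (continuous_disc (α + g)).continuousOn
    obtain ⟨E, hE, h0⟩ := h3 ⟨h1.le, (by norm_num : (0 : ℝ) ≤ 5).trans (hE₀ _ (min_le_left _ _))⟩
    refine ⟨E, lt_of_le_of_ne hE.2 fun h => by rw [h] at h0; linarith, Pi.single 1 1,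
      ⟨1, by simp⟩, ?_, fun j => ?_⟩
    · refine summable_of_hasFiniteSupport ((Set.finite_singleton (1 : ℤ)).subset fun j hj => ?_)
      by_contra hne
      exact hj (by simp [show j ≠ 1 from hne])
    · rcases eq_or_ne j 1 with rfl | hj
      · rw [if_pos ⟨le_rfl, by exact_mod_cast hm⟩, h0]; simp
      · simp [Pi.single_apply, hj]
  · rw [abs_of_pos hc] at hc2 hb hlt
    exact exists_bound_state_of_pos hc hc2 hg hb1 hb hlt hm


/-! ### The Jacobi equation in `ℓ²(ℤ)` -/

theorem memlp_two_iff {x : ℤ → ℂ} : Memℓp x 2 ↔ Summable fun j => ‖x j‖ ^ 2 := by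
  rw [memℓp_gen_iff (by norm_num)]
  norm_num

theorem lp_two_norm_sq (x : lp (fun _ : ℤ => ℂ) 2) : ‖x‖ ^ 2 = ∑' j, ‖x j‖ ^ 2 := by
  have := lp.norm_rpow_eq_tsum (p := 2) (by norm_num) x
  norm_num at this
  exact this

theorem summable_shift {f : ℤ → ℝ} (hf : Summable f) (k : ℤ) : Summable fun j => f (j + k) :=
  (Equiv.addRight k).summable_iff.2 hf

theorem tsum_shift (f : ℤ → ℝ) (k : ℤ) : ∑' j, f (j + k) = ∑' j, f j :=
  (Equiv.addRight k).tsum_eq f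

theorem norm_add_sq_le_two_mul (x y : ℂ) : ‖x + y‖ ^ 2 ≤ 2 * (‖x‖ ^ 2 + ‖y‖ ^ 2) := by
  have h := norm_add_le x y
  have := norm_nonneg (x + y)
  nlinarith [sq_nonneg (‖x‖ - ‖y‖), norm_nonneg x, norm_nonneg y]

/-- Both shifts are isometries of `ℓ²`, so the operator norm is at most `2 * k`. -/
theorem summable_neighbours {x : ℤ → ℂ} (hx : Summable fun j => ‖x j‖ ^ 2) {a : ℤ → ℂ} {k : ℝ}
    (ha : ∀ j, ‖a j‖ ≤ k) :
    (Summable fun j => ‖a j * (x (j + 1) + x (j - 1))‖ ^ 2) ∧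
      ∑' j, ‖a j * (x (j + 1) + x (j - 1))‖ ^ 2 ≤ (2 * k) ^ 2 * ∑' j, ‖x j‖ ^ 2 := by
  have h1 := summable_shift hx 1
  have h2 := summable_shift hx (-1)
  have hs : Summable fun j => 2 * k ^ 2 * (‖x (j + 1)‖ ^ 2 + ‖x (j + -1)‖ ^ 2) :=
    (h1.add h2).mul_left _
  have hle : ∀ j, ‖a j * (x (j + 1) + x (j - 1))‖ ^ 2 ≤
      2 * k ^ 2 * (‖x (j + 1)‖ ^ 2 + ‖x (j + -1)‖ ^ 2) := fun j => by
    rw [norm_mul, mul_pow, ← sub_eq_add_neg]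
    have h3 := norm_add_sq_le_two_mul (x (j + 1)) (x (j - 1))
    have h4 : ‖a j‖ ^ 2 ≤ k ^ 2 := pow_le_pow_left₀ (norm_nonneg _) (ha j) 2
    calc ‖a j‖ ^ 2 * ‖x (j + 1) + x (j - 1)‖ ^ 2
        ≤ k ^ 2 * (2 * (‖x (j + 1)‖ ^ 2 + ‖x (j - 1)‖ ^ 2)) := by gcongr
      _ = _ := by ring
  have hsum := hs.of_nonneg_of_le (fun j => by positivity) hle
  refine ⟨hsum, (hsum.tsum_le_tsum hle hs).trans_eq ?_⟩
  rw [tsum_mul_left, h1.tsum_add h2, tsum_shift (fun j => ‖x j‖ ^ 2),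
    tsum_shift (fun j => ‖x j‖ ^ 2)]
  ring

/-- Diagonal dominance: after division by `d j`, the sequence is a fixed point of a linear map of
norm at most `2 * |c| / D < 1`. -/
theorem jacobi_eq_zero {d : ℤ → ℝ} {c D : ℝ} (hD : 2 * |c| < D) (hd : ∀ j, D ≤ d j)
    {q : ℤ → ℂ} (hq : Summable fun j => ‖q j‖ ^ 2)
    (h : ∀ j, d j * q j - c * (q (j + 1) + q (j - 1)) = 0) (j : ℤ) : q j = 0 := by
  have hD0 : 0 < D := (by positivity : 0 ≤ 2 * |c|).trans_lt hD
  have hd0 : ∀ j, 0 < d j := fun j => hD0.trans_le (hd j)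
  have ha : ∀ j, ‖((c / d j : ℝ) : ℂ)‖ ≤ |c| / D := fun j => by
    rw [Complex.norm_real, Real.norm_eq_abs, abs_div, abs_of_pos (hd0 j)]
    have := hd j
    gcongr
  obtain ⟨-, hle⟩ := summable_neighbours hq ha
  have heq : ∀ j, ((c / d j : ℝ) : ℂ) * (q (j + 1) + q (j - 1)) = q j := fun j => by
    have h1 : (d j : ℂ) ≠ 0 := by exact_mod_cast (hd0 j).ne'
    push_cast
    field_simp
    linear_combination -h j
  simp only [heq] at hle
  have hk : (2 * (|c| / D)) ^ 2 < 1 := by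
    have h2 : 2 * (|c| / D) < 1 := by rw [mul_div_assoc', div_lt_one hD0]; exact hD
    have h3 : 0 ≤ 2 * (|c| / D) := by positivity
    nlinarith
  have h0 : ‖q j‖ ^ 2 ≤ ∑' j, ‖q j‖ ^ 2 := hq.le_tsum j fun i _ => by positivity
  have h2 : 0 ≤ ∑' j, ‖q j‖ ^ 2 := tsum_nonneg fun j => by positivity
  have h1 : ‖q j‖ ^ 2 ≤ 0 := by nlinarith
  simpa using h1

/-- After division by `d j` the equation reads `(1 - T) q = ρ` with `‖T‖ < 1`, which is invertible.
The bound follows from `‖q‖ ≤ ‖ρ‖ + ‖T q‖`, multiplied by `D`. -/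
theorem exists_jacobi_solution {d : ℤ → ℝ} {c D : ℝ} (hD : 2 * |c| < D) (hd : ∀ j, D ≤ d j)
    {r : ℤ → ℂ} (hr : Summable fun j => ‖r j‖ ^ 2) :
    ∃ q : ℤ → ℂ, Summable (fun j => ‖q j‖ ^ 2) ∧
      ∑' j, ‖q j‖ ^ 2 ≤ (1 / (D - 2 * |c|)) ^ 2 * ∑' j, ‖r j‖ ^ 2 ∧
      ∀ j, d j * q j - c * (q (j + 1) + q (j - 1)) = r j := by
  have hD0 : 0 < D := (by positivity : 0 ≤ 2 * |c|).trans_lt hD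
  have hd0 : ∀ j, 0 < d j := fun j => hD0.trans_le (hd j)
  have ha : ∀ j, ‖((c / d j : ℝ) : ℂ)‖ ≤ |c| / D := fun j => by
    rw [Complex.norm_real, Real.norm_eq_abs, abs_div, abs_of_pos (hd0 j)]
    have := hd j
    gcongr
  let X := lp (fun _ : ℤ => ℂ) 2
  let k : ℝ := 2 * (|c| / D)
  have hk0 : 0 ≤ k := by positivity
  have hk : k < 1 := by
    simp only [k]
    rw [mul_div_assoc', div_lt_one hD0]; exact hD
  have hx (x : X) : Summable fun j => ‖x j‖ ^ 2 := memlp_two_iff.1 x.2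
  let T₀ : X →ₗ[ℂ] X :=
    { toFun := fun x => ⟨fun j => ((c / d j : ℝ) : ℂ) * (x (j + 1) + x (j - 1)),
        memlp_two_iff.2 (summable_neighbours (hx x) ha).1⟩
      map_add' := fun x y => by
        ext j
        change _ * (x (j + 1) + y (j + 1) + (x (j - 1) + y (j - 1))) =
          _ * (x (j + 1) + x (j - 1)) + _ * (y (j + 1) + y (j - 1))
        ring
      map_smul' := fun a x => by
        ext j
        change _ * (a * x (j + 1) + a * x (j - 1)) = a * (_ * (x (j + 1) + x (j - 1)))
        ring }
  have hT₀ : ∀ x, ‖T₀ x‖ ≤ k * ‖x‖ := fun x => by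
    refine le_of_sq_le_sq ?_ (by positivity)
    rw [mul_pow, lp_two_norm_sq, lp_two_norm_sq]
    exact (summable_neighbours (hx x) ha).2
  let T : X →L[ℂ] X := T₀.mkContinuous k hT₀
  have hT : ‖T‖ < 1 := (T₀.mkContinuous_norm_le hk0 hT₀).trans_lt hk
  have hr' : ∀ j, ‖((d j)⁻¹ : ℂ) * r j‖ ^ 2 ≤ (1 / D) ^ 2 * ‖r j‖ ^ 2 := fun j => by
    rw [norm_mul, mul_pow, norm_inv, Complex.norm_real, Real.norm_eq_abs, abs_of_pos (hd0 j),
      inv_eq_one_div]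
    have := hd j
    have := hd0 j
    gcongr
  have hs' : Summable fun j => ‖((d j)⁻¹ : ℂ) * r j‖ ^ 2 :=
    (hr.mul_left _).of_nonneg_of_le (fun j => by positivity) hr'
  let ρ : X := ⟨fun j => ((d j)⁻¹ : ℂ) * r j, memlp_two_iff.2 hs'⟩
  have hρ : ‖ρ‖ ≤ 1 / D * √(∑' j, ‖r j‖ ^ 2) := by
    refine le_of_sq_le_sq ?_ (by positivity)
    rw [mul_pow, Real.sq_sqrt (tsum_nonneg fun j => by positivity), lp_two_norm_sq,
      ← tsum_mul_left]
    exact hs'.tsum_le_tsum hr' (hr.mul_left _)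
  obtain ⟨u, hu⟩ := isUnit_one_sub_of_norm_lt_one hT
  let q : X := (↑u⁻¹ : X →L[ℂ] X) ρ
  have hq : q - T q = ρ := by
    have h1 : ((u : X →L[ℂ] X) * (↑u⁻¹ : X →L[ℂ] X)) ρ = ρ := by rw [u.mul_inv]; rfl
    rw [hu] at h1
    exact h1
  have hqn : ‖q‖ ≤ 1 / (D - 2 * |c|) * √(∑' j, ‖r j‖ ^ 2) := by
    have h1 : ‖q‖ ≤ 1 / D * √(∑' j, ‖r j‖ ^ 2) + k * ‖q‖ := by
      calc ‖q‖ = ‖ρ + T q‖ := by rw [← hq]; congr 1; abel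
        _ ≤ ‖ρ‖ + ‖T q‖ := norm_add_le _ _
        _ ≤ _ := add_le_add hρ (hT₀ q)
    have h2 : D * k = 2 * |c| := by simp only [k]; field_simp
    rw [div_mul_eq_mul_div, one_mul, le_div_iff₀ (by linarith)]
    have h3 : D * ‖q‖ ≤ D * (1 / D * √(∑' j, ‖r j‖ ^ 2) + k * ‖q‖) := by gcongr
    have h4 : D * (1 / D * √(∑' j, ‖r j‖ ^ 2) + k * ‖q‖) =
        √(∑' j, ‖r j‖ ^ 2) + D * k * ‖q‖ := by field_simp
    rw [h4, h2] at h3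
    linarith
  refine ⟨q, hx q, ?_, fun j => ?_⟩
  · rw [← lp_two_norm_sq, ← Real.sq_sqrt (tsum_nonneg fun j => by positivity : 0 ≤ ∑' j, ‖r j‖ ^ 2),
      ← mul_pow]
    exact pow_le_pow_left₀ (norm_nonneg _) hqn 2
  · have h1 : q j - ((c / d j : ℝ) : ℂ) * (q (j + 1) + q (j - 1)) = ((d j)⁻¹ : ℂ) * r j :=
      congrArg (fun x : X => x j) hq
    have h2 : (d j : ℂ) ≠ 0 := by exact_mod_cast (hd0 j).ne'
    push_cast at h1
    field_simp at h1
    linear_combination h1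

/-- At the band edge, the Jacobi equation has no `ℓ²` solution for certain right-hand sides. -/
theorem jacobi_bandEdge_eq_zero {c : ℝ} {q r : ℤ → ℂ} (hq : Summable fun j => ‖q j‖ ^ 2)
    (hr : ∀ j, j ≠ 0 → j ≠ 1 → r j = 0)
    (h : ∀ j, ((2 * |c| : ℝ) : ℂ) * q j - c * (q (j + 1) + q (j - 1)) = r j) : r 0 = 0 := by
  have hq0 : Filter.Tendsto q Filter.cofinite (nhds 0) := by
    have h1 := hq.tendsto_cofinite_zero
    rw [tendsto_zero_iff_norm_tendsto_zero]
    have h2 := h1.sqrt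
    simpa using h2
  wlog hc : 0 ≤ c generalizing c q r
  · refine by_contra fun hne => ?_
    have hc' : 0 ≤ -c := by linarith
    have hsgn (j : ℤ) : ((-1 : ℂ)) ^ (j + 1) = -(-1) ^ j := by
      rw [zpow_add_one₀ (by norm_num)]; ring
    have hsgn' (j : ℤ) : ((-1 : ℂ)) ^ (j - 1) = -(-1) ^ j := by
      rw [zpow_sub_one₀ (by norm_num)]; norm_num
    have hn : ∀ j, ‖(-1 : ℂ) ^ j * q j‖ = ‖q j‖ := fun j => by simp
    have := this (c := -c) (q := fun j => (-1) ^ j * q j) (r := fun j => (-1) ^ j * r j)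
      (by simpa only [hn] using hq) (fun j h0 h1 => by simp [hr j h0 h1]) (fun j => by
        simp only [hsgn, hsgn', abs_neg]
        rw [← h j]
        push_cast
        ring) (by
        rw [tendsto_zero_iff_norm_tendsto_zero] at hq0 ⊢
        simpa only [hn] using hq0) hc'
    exact hne (by simpa using this)
  rcases hc.eq_or_lt with rfl | hc
  · simpa using (h 0).symm
  rw [abs_of_pos hc] at h
  have hc0 : (c : ℂ) ≠ 0 := by exact_mod_cast hc.ne'
  -- At the edge the second difference of `q` vanishes away from the source, so `q` is affine on
  -- both half-lines. Decay then makes it zero on `j ≥ 1` and on `j ≤ 0`, that is, everywhere.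
  have hrec : ∀ j, j ≠ 0 → j ≠ 1 → q (j + 1) - q j = q j - q (j - 1) := fun j h0 h1 => by
    have h2 := h j
    rw [hr j h0 h1] at h2
    push_cast at h2
    refine mul_left_cancel₀ hc0 ?_
    linear_combination -h2
  have htop : Filter.Tendsto (fun n : ℕ => (n : ℤ)) Filter.atTop Filter.cofinite := by
    rw [← Nat.cofinite_eq_atTop]
    exact Nat.cast_injective.tendsto_cofinite
  -- a solution of the free recursion on a half-line that tends to zero vanishes
  have hlin : ∀ p : ℕ → ℂ, (∀ n, p (n + 2) - p (n + 1) = p (n + 1) - p n) →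
      Filter.Tendsto p Filter.atTop (nhds 0) → ∀ n, p n = 0 := fun p hp hp0 => by
    have h1 : ∀ n, p (n + 1) - p n = p 1 - p 0 := fun n => by
      induction n with
      | zero => rfl
      | succ n ih => rw [← ih]; exact hp n
    have h2 : Filter.Tendsto (fun n => p (n + 1) - p n) Filter.atTop (nhds (0 - 0)) :=
      ((Filter.tendsto_add_atTop_iff_nat 1).2 hp0).sub hp0
    have h3 : p 1 - p 0 = 0 := by
      simp only [h1, sub_zero] at h2
      exact tendsto_nhds_unique tendsto_const_nhds h2
    have h4 : ∀ n, p n = p 0 := fun n => by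
      induction n with
      | zero => rfl
      | succ n ih => rw [← ih, ← sub_eq_zero, h1, h3]
    have h5 : p 0 = 0 := by
      rw [funext h4] at hp0
      exact tendsto_nhds_unique tendsto_const_nhds hp0
    intro n
    rw [h4, h5]
  have hp : ∀ n : ℕ, q (n + 1) = 0 := by
    refine hlin (fun n => q (n + 1)) (fun n => ?_) ?_
    · have := hrec (n + 2) (by lia) (by lia)
      convert! this using 2
      · ring_nf
    · exact hq0.comp ((add_left_injective (1 : ℤ)).tendsto_cofinite.comp htop)
  have hm : ∀ n : ℕ, q (-n) = 0 := by
    refine hlin (fun n => q (-n)) (fun n => ?_) ?_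
    · have := hrec (-(n + 1)) (by lia) (by lia)
      have e1 : (-((n : ℤ) + 1) + 1) = -n := by ring
      have e2 : (-((n : ℤ) + 1) - 1) = -(n + 2) := by ring
      rw [e1, e2] at this
      push_cast
      linear_combination this
    · exact hq0.comp (neg_injective.tendsto_cofinite.comp htop)
  have h1 := hp 0
  have h2 := hm 0
  have h3 := hm 1
  rw [← h 0]
  norm_num at h1 h2 h3 ⊢
  rw [h1, h2, h3]
  simp


section

/-! ### Absolutely continuous functions on an edge -/

theorem absolutelyContinuous_congr {a b : ℝ} {f g : ℝ → ℂ}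
    (hf : AbsolutelyContinuousOnInterval f a b) (h : Set.EqOn f g (Set.uIcc a b)) :
    AbsolutelyContinuousOnInterval g a b := by
  rw [absolutelyContinuousOnInterval_iff] at hf ⊢
  intro ε hε
  obtain ⟨δ, hδ, H⟩ := hf ε hε
  refine ⟨δ, hδ, fun E hE hlt => (Finset.sum_congr rfl fun i hi => ?_).trans_lt (H E hE hlt)⟩
  rw [h (hE.1 i hi).1, h (hE.1 i hi).2]

/-- `f` is absolutely continuous on `[a, b]` with derivative `f'`. -/
structure IsPrimitive (a b : ℝ) (f f' : ℝ → ℂ) : Prop where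
  integrable : IntervalIntegrable f' volume a b
  eq : ∀ x ∈ Set.Icc a b, f x = f a + ∫ t in a..x, f' t

theorem absolutelyContinuous_integral {a b : ℝ} {f : ℝ → ℂ}
    (hf : IntervalIntegrable f volume a b) :
    AbsolutelyContinuousOnInterval (fun x => ∫ t in a..x, f t) a b := by
  have hre : IntervalIntegrable (fun t => (f t).re) volume a b :=
    ⟨hf.1.re, hf.2.re⟩
  have him : IntervalIntegrable (fun t => (f t).im) volume a b :=
    ⟨hf.1.im, hf.2.im⟩
  have hconst (z : ℂ) : AbsolutelyContinuousOnInterval (fun _ : ℝ => z) a b :=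
    (LipschitzWith.const z).lipschitzOnWith.absolutelyContinuousOnInterval
  have h1 := (hre.absolutelyContinuousOnInterval_intervalIntegral
    Set.left_mem_uIcc).fun_smul (hconst 1)
  have h2 := (him.absolutelyContinuousOnInterval_intervalIntegral
    Set.left_mem_uIcc).fun_smul (hconst Complex.I)
  have h3 := h1.add h2
  have key : ∀ x ∈ Set.uIcc a b, ∫ t in a..x, f t =
      (∫ t in a..x, (f t).re) • (1 : ℂ) + (∫ t in a..x, (f t).im) • Complex.I := fun x hx => by
    have hs : Set.uIcc a x ⊆ Set.uIcc a b := Set.uIcc_subset_uIcc_left hx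
    have hr := hre.mono_set hs
    have hi := him.mono_set hs
    simp only [Complex.real_smul, mul_one]
    rw [← intervalIntegral.integral_ofReal, ← intervalIntegral.integral_ofReal,
      ← intervalIntegral.integral_mul_const, ← intervalIntegral.integral_add]
    · simp only [Complex.re_add_im]
    · exact ⟨hr.1.ofReal, hr.2.ofReal⟩
    · exact (show IntervalIntegrable (fun t => ((f t).im : ℂ)) volume a x from
        ⟨hi.1.ofReal, hi.2.ofReal⟩).mul_const _
  exact absolutelyContinuous_congr h3 fun x hx => (key x hx).symm

namespace IsPrimitive

variable {a b : ℝ} {f f' g g' : ℝ → ℂ}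

theorem absolutelyContinuous (hab : a ≤ b) (h : IsPrimitive a b f f') :
    AbsolutelyContinuousOnInterval f a b := by
  have hc : AbsolutelyContinuousOnInterval (fun _ : ℝ => f a) a b :=
    (LipschitzWith.const (f a)).lipschitzOnWith.absolutelyContinuousOnInterval
  refine absolutelyContinuous_congr (hc.add (absolutelyContinuous_integral h.integrable))
    fun x hx => ?_
  rw [Set.uIcc_of_le hab] at hx
  exact (h.eq x hx).symm

theorem continuousOn (hab : a ≤ b) (h : IsPrimitive a b f f') : ContinuousOn f (Set.Icc a b) := by
  have := (h.absolutelyContinuous hab).continuousOn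
  rwa [Set.uIcc_of_le hab] at this

theorem ae_hasDerivAt (hab : a ≤ b) (h : IsPrimitive a b f f') :
    ∀ᵐ x, x ∈ Set.Ioo a b → HasDerivAt f (f' x) x := by
  filter_upwards [h.integrable.ae_hasDerivAt_integral] with x hx hxab
  have h1 := hx (by rw [Set.uIcc_of_le hab]; exact Set.Ioo_subset_Icc_self hxab) a
    Set.left_mem_uIcc
  refine (h1.const_add (f a)).congr_of_eventuallyEq ?_
  filter_upwards [isOpen_Ioo.mem_nhds hxab] with y hy
  exact h.eq y (Set.Ioo_subset_Icc_self hy)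

/-- The product rule for absolutely continuous functions. -/
theorem mul (hab : a ≤ b) (hf : IsPrimitive a b f f') (hg : IsPrimitive a b g g') :
    IsPrimitive a b (fun x => f x * g x) (fun x => f' x * g x + f x * g' x) := by
  have hfc := hf.continuousOn hab
  have hgc := hg.continuousOn hab
  rw [← Set.uIcc_of_le hab] at hfc hgc
  have hint : IntervalIntegrable (fun x => f' x * g x + f x * g' x) volume a b :=
    (hf.integrable.mul_continuousOn hgc).add (hg.integrable.continuousOn_mul hfc)
  refine ⟨hint, fun x hx => ?_⟩
  -- The product minus the primitive of its expected derivative is absolutely continuous with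
  -- derivative zero almost everywhere, hence constant.
  have hAC := ((hf.absolutelyContinuous hab).fun_smul (hg.absolutelyContinuous hab)).sub
    (absolutelyContinuous_integral hint)
  obtain ⟨C, hC⟩ := hAC.const_of_ae_hasDerivAt_zero (by
    have hne : ∀ᵐ x : ℝ, x ≠ a ∧ x ≠ b := by
      filter_upwards [Measure.ae_ne volume a, Measure.ae_ne volume b] with x h1 h2 using ⟨h1, h2⟩
    filter_upwards [hf.ae_hasDerivAt hab, hg.ae_hasDerivAt hab, hint.ae_hasDerivAt_integral, hne]
      with x h1 h2 h3 h4 hx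
    have hx' := hx
    rw [Set.uIcc_of_le hab] at hx'
    have hxo : x ∈ Set.Ioo a b :=
      ⟨lt_of_le_of_ne hx'.1 h4.1.symm, lt_of_le_of_ne hx'.2 h4.2⟩
    have := ((h1 hxo).mul (h2 hxo)).sub (h3 hx a Set.left_mem_uIcc)
    rw [sub_self] at this
    exact this)
  have h1 := hC x (by rwa [Set.uIcc_of_le hab])
  have h2 := hC a Set.left_mem_uIcc
  simp only [Pi.sub_apply, smul_eq_mul, intervalIntegral.integral_same, sub_zero] at h1 h2
  rw [← h2, sub_eq_iff_eq_add] at h1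
  exact h1

theorem add (hab : a ≤ b) (hf : IsPrimitive a b f f') (hg : IsPrimitive a b g g') :
    IsPrimitive a b (fun x => f x + g x) (fun x => f' x + g' x) := by
  refine ⟨hf.integrable.add hg.integrable, fun x hx => ?_⟩
  have hs : Set.uIcc a x ⊆ Set.uIcc a b := by
    rw [Set.uIcc_of_le hab, Set.uIcc_of_le hx.1]
    exact Set.Icc_subset_Icc_right hx.2
  rw [intervalIntegral.integral_add (hf.integrable.mono_set hs) (hg.integrable.mono_set hs),
    hf.eq x hx, hg.eq x hx]
  ring

theorem const_mul (c : ℂ) (hf : IsPrimitive a b f f') :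
    IsPrimitive a b (fun x => c * f x) (fun x => c * f' x) := by
  refine ⟨hf.integrable.const_mul c, fun x hx => ?_⟩
  rw [intervalIntegral.integral_const_mul, hf.eq x hx]
  ring

theorem const (c : ℂ) : IsPrimitive a b (fun _ => c) (fun _ => 0) :=
  ⟨intervalIntegrable_const, fun x _ => by simp⟩

theorem of_integrable (hg : IntervalIntegrable g volume a b) :
    IsPrimitive a b (fun x => ∫ t in a..x, g t) g :=
  ⟨hg, fun x _ => by simp⟩

theorem of_hasDerivAt (hf : ∀ x, HasDerivAt f (f' x) x) (hf' : Continuous f') :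
    IsPrimitive a b f f' := by
  refine ⟨hf'.intervalIntegrable a b, fun x _ => ?_⟩
  rw [intervalIntegral.integral_eq_sub_of_hasDerivAt (fun y _ => hf y)
    (hf'.intervalIntegrable a x)]
  ring

theorem congr (h : IsPrimitive a b f f') (hg : ∀ x, g x = f x) (hg' : ∀ x, g' x = f' x) :
    IsPrimitive a b g g' := by
  rw [funext hg, funext hg']; exact h

theorem eq_right (hab : a ≤ b) (h : IsPrimitive a b f f') : ∫ t in a..b, f' t = f b - f a := by
  rw [h.eq b (Set.right_mem_Icc.2 hab)]; ring

end IsPrimitive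

end


/-! ### The differential equation on an edge -/

theorem HasSobolevDerivs.isPrimitive {a b : ℝ} (hab : a ≤ b) {u v w : ℝ → ℂ}
    (h : HasSobolevDerivs a b u v w) : IsPrimitive a b u v ∧ IsPrimitive a b v w :=
  have hi := h.intervalIntegrable (Set.right_mem_Icc.2 hab)
  ⟨⟨hi.2, h.self_eq⟩, ⟨hi.1, h.deriv_eq⟩⟩

/-- The gauge factor on an edge with left endpoint `a`. -/
def gauge (c : ℂ) (a x : ℝ) : ℂ := Complex.exp (c * (x - a : ℝ))

theorem continuous_gauge (c : ℂ) (a : ℝ) : Continuous (gauge c a) := by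
  unfold gauge
  fun_prop

@[simp] theorem gauge_self (c : ℂ) (a : ℝ) : gauge c a a = 1 := by simp [gauge]

theorem gauge_neg_mul (c : ℂ) (a x : ℝ) : gauge (-c) a x * gauge c a x = 1 := by
  rw [gauge, gauge, ← Complex.exp_add]; simp

theorem hasDerivAt_gauge (c : ℂ) (a x : ℝ) : HasDerivAt (gauge c a) (c * gauge c a x) x := by
  have h : HasDerivAt (fun x : ℝ => c * ((x - a : ℝ) : ℂ)) c x := by
    simpa using (((hasDerivAt_id' x).sub_const a).ofReal_comp.const_mul c)
  have := h.cexp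
  rw [mul_comm] at this
  exact this

theorem norm_gauge_coeff (A : ℝ) (s : Bool) (a x : ℝ) : ‖gauge (coeff A s) a x‖ = 1 := by
  rw [gauge, Complex.norm_exp]
  cases s <;> simp [coeff]

theorem norm_gauge_neg_coeff (A : ℝ) (s : Bool) (a x : ℝ) : ‖gauge (-coeff A s) a x‖ = 1 := by
  rw [gauge, Complex.norm_exp]
  cases s <;> simp [coeff]

/-- The gauge factor turns the quasiderivative into an ordinary derivative, which removes the vector
potential from the edge equation; only a phase at the right endpoint survives. -/
theorem IsPrimitive.gauge_mul {a b : ℝ} (hab : a ≤ b) (c : ℂ) {u v : ℝ → ℂ}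
    (h : IsPrimitive a b u v) :
    IsPrimitive a b (fun x => gauge c a x * u x) (fun x => gauge c a x * quasiDeriv c u v x) := by
  have hg : IsPrimitive a b (gauge c a) (fun x => c * gauge c a x) :=
    IsPrimitive.of_hasDerivAt (hasDerivAt_gauge c a) (continuous_const.mul (continuous_gauge c a))
  refine (hg.mul hab h).congr (fun x => rfl) fun x => ?_
  simp only [quasiDeriv]
  ring

theorem IsPrimitive.quasiDeriv {a b : ℝ} (hab : a ≤ b) (c : ℂ) {u v w : ℝ → ℂ}
    (h : IsPrimitive a b u v) (h' : IsPrimitive a b v w) :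
    IsPrimitive a b (quasiDeriv c u v) (quasiDeriv c v w) :=
  h'.add hab (h.const_mul c)

theorem IsPrimitive.mono {a b x : ℝ} {u v : ℝ → ℂ} (h : IsPrimitive a b u v)
    (hx : x ∈ Set.Icc a b) : IsPrimitive a x u v := by
  refine ⟨h.integrable.mono_set ?_, fun y hy => h.eq y ⟨hy.1, hy.2.trans hx.2⟩⟩
  rw [Set.uIcc_of_le hx.1, Set.uIcc_of_le (hx.1.trans hx.2)]
  exact Set.Icc_subset_Icc_right hx.2

/-- Green's formula with a smooth test function. -/
theorem green {a b : ℝ} (hab : a ≤ b) {u v w χ χ' χ'' : ℝ → ℂ}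
    (h : IsPrimitive a b u v) (h' : IsPrimitive a b v w)
    (hχ : ∀ x, HasDerivAt χ (χ' x) x) (hχ' : ∀ x, HasDerivAt χ' (χ'' x) x)
    (hc : Continuous χ'') :
    ∫ x in a..b, (χ x * w x - χ'' x * u x) = χ b * v b - χ' b * u b - (χ a * v a - χ' a * u a) := by
  have hc' : Continuous χ' := continuous_iff_continuousAt.2 fun x => (hχ' x).continuousAt
  have h1 := (IsPrimitive.of_hasDerivAt (a := a) (b := b) hχ hc').mul hab h'
  have h2 := (IsPrimitive.of_hasDerivAt (a := a) (b := b) hχ' hc).mul hab h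
  have h3 := h1.add hab (h2.const_mul (-1))
  have h4 := h3.eq_right hab
  rw [show χ b * v b - χ' b * u b - (χ a * v a - χ' a * u a) =
    χ b * v b + -1 * (χ' b * u b) - (χ a * v a + -1 * (χ' a * u a)) by ring, ← h4]
  refine intervalIntegral.integral_congr fun x _ => ?_
  ring

theorem hasDerivAt_sinE_sub (E a x : ℝ) :
    HasDerivAt (fun x : ℝ => (sinE E (x - a) : ℂ)) (cosE E (x - a)) x :=
  ((hasDerivAt_sinE E (x - a)).comp_sub_const x a).ofReal_comp

theorem hasDerivAt_cosE_sub (E a x : ℝ) :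
    HasDerivAt (fun x : ℝ => (cosE E (x - a) : ℂ)) (-E * sinE E (x - a)) x := by
  simpa using ((hasDerivAt_cosE E (x - a)).comp_sub_const x a).ofReal_comp

theorem hasDerivAt_sinE_rev (E b x : ℝ) :
    HasDerivAt (fun x : ℝ => (sinE E (b - x) : ℂ)) (-cosE E (b - x)) x := by
  simpa using ((hasDerivAt_sinE E (b - x)).comp_const_sub b x).ofReal_comp

theorem hasDerivAt_cosE_rev (E b x : ℝ) :
    HasDerivAt (fun x : ℝ => (-cosE E (b - x) : ℂ)) (-E * sinE E (b - x)) x := by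
  have := ((hasDerivAt_cosE E (b - x)).comp_const_sub b x).ofReal_comp.neg
  convert! this using 1
  simp

/-- Green's formula with the solution that vanishes at the left endpoint. -/
theorem green_sinE_left {a b E : ℝ} (hab : a ≤ b) {u v w : ℝ → ℂ}
    (h : IsPrimitive a b u v) (h' : IsPrimitive a b v w) :
    ∫ x in a..b, (sinE E (x - a) : ℂ) * (w x + E * u x) =
      sinE E (b - a) * v b - cosE E (b - a) * u b + u a := by
  have hc : Continuous fun x : ℝ => (-E * sinE E (x - a) : ℂ) := by
    have := continuous_sinE E
    fun_prop
  have := green hab h h' (hasDerivAt_sinE_sub E a) (hasDerivAt_cosE_sub E a) hc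
  simp only [sub_self, sinE_zero, cosE_zero] at this
  rw [show (sinE E (b - a) * v b - cosE E (b - a) * u b + u a : ℂ) =
    sinE E (b - a) * v b - cosE E (b - a) * u b - ((0 : ℝ) * v a - (1 : ℝ) * u a) by
      push_cast; ring, ← this]
  refine intervalIntegral.integral_congr fun x _ => ?_
  ring

/-- Green's formula with the solution that vanishes at the right endpoint. -/
theorem green_sinE_right {a b E : ℝ} (hab : a ≤ b) {u v w : ℝ → ℂ}
    (h : IsPrimitive a b u v) (h' : IsPrimitive a b v w) :
    ∫ x in a..b, (sinE E (b - x) : ℂ) * (w x + E * u x) =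
      u b - sinE E (b - a) * v a - cosE E (b - a) * u a := by
  have hc : Continuous fun x : ℝ => (-E * sinE E (b - x) : ℂ) := by
    have := continuous_sinE E
    fun_prop
  have := green hab h h' (hasDerivAt_sinE_rev E b) (hasDerivAt_cosE_rev E b) hc
  simp only [sub_self, sinE_zero, cosE_zero] at this
  rw [show (u b - sinE E (b - a) * v a - cosE E (b - a) * u a : ℂ) =
    (0 : ℝ) * v b - -(1 : ℝ) * u b - (sinE E (b - a) * v a - -cosE E (b - a) * u a) by
      push_cast; ring, ← this]
  refine intervalIntegral.integral_congr fun x _ => ?_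
  ring

/-- A solution of the homogeneous equation with zero boundary values vanishes. -/
theorem edge_unique {a b E : ℝ} (hab : a ≤ b) (hS : sinE E (b - a) ≠ 0) {u v w : ℝ → ℂ}
    (h : IsPrimitive a b u v) (h' : IsPrimitive a b v w)
    (hw : ∀ᵐ x ∂(volume.restrict (Set.Ioo a b)), w x + E * u x = 0) (ha : u a = 0) (hb : u b = 0) :
    ∀ x ∈ Set.Icc a b, u x = 0 := by
  have hz : ∀ (k : ℝ → ℂ), ∀ x ∈ Set.Icc a b, ∫ t in a..x, k t * (w t + E * u t) = 0 := by
    intro k x hx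
    rw [intervalIntegral.integral_of_le hx.1, integral_Ioc_eq_integral_Ioo]
    refine integral_eq_zero_of_ae ?_
    filter_upwards [ae_restrict_of_ae_restrict_of_subset (Set.Ioo_subset_Ioo_right hx.2) hw]
      with t ht
    simp [ht]
  -- Green's formula over the whole edge kills the initial slope; over `[a, x]` it then gives `u x =
  -- 0`.
  have hva : v a = 0 := by
    have h1 := green_sinE_right (E := E) hab h h'
    rw [hz _ b (Set.right_mem_Icc.2 hab), ha, hb] at h1
    have h2 : (sinE E (b - a) : ℂ) ≠ 0 := by exact_mod_cast hS
    simpa [h2] using h1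
  intro x hx
  have h1 := green_sinE_right (E := E) hx.1 (h.mono hx) (h'.mono hx)
  rw [hz _ x hx, ha, hva] at h1
  simpa using h1.symm

/-- Cauchy–Schwarz, obtained by expanding the nonnegative variance of `‖g‖`. -/
theorem sq_integral_norm_le {a b : ℝ} (hab : a < b) {g : ℝ → ℂ}
    (hg : MemLp g 2 (volume.restrict (Set.Ioo a b))) :
    (∫ x in Set.Ioo a b, ‖g x‖) ^ 2 ≤ (b - a) * ∫ x in Set.Ioo a b, ‖g x‖ ^ 2 := by
  have h1 : Integrable (fun x => ‖g x‖) (volume.restrict (Set.Ioo a b)) :=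
    (hg.integrable (by norm_num)).norm
  have h2 : Integrable (fun x => ‖g x‖ ^ 2) (volume.restrict (Set.Ioo a b)) :=
    (memLp_two_iff_integrable_sq_norm hg.1).1 hg
  set m := ∫ x in Set.Ioo a b, ‖g x‖ with hm
  have h3 : 0 ≤ ∫ x in Set.Ioo a b, (‖g x‖ - m / (b - a)) ^ 2 :=
    integral_nonneg fun x => sq_nonneg _
  have h4 : ∫ x in Set.Ioo a b, (‖g x‖ - m / (b - a)) ^ 2 =
      (∫ x in Set.Ioo a b, ‖g x‖ ^ 2) - 2 * (m / (b - a)) * m + (m / (b - a)) ^ 2 * (b - a) := by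
    have h5 : ∀ x, (‖g x‖ - m / (b - a)) ^ 2 =
      ‖g x‖ ^ 2 - 2 * (m / (b - a)) * ‖g x‖ + (m / (b - a)) ^ 2 := fun x => by ring
    simp only [h5]
    rw [integral_add (f := fun x => ‖g x‖ ^ 2 - 2 * (m / (b - a)) * ‖g x‖)
      (h2.sub (h1.const_mul _)) (integrable_const _), integral_sub h2 (h1.const_mul _), integral_const_mul, integral_const]
    simp [hab.le, mul_comm, ← hm]
  have h6 : 0 < b - a := sub_pos.2 hab
  rw [h4] at h3
  have h7 : 2 * (m / (b - a)) * m - (m / (b - a)) ^ 2 * (b - a) = m ^ 2 / (b - a) := by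
    field_simp; ring
  rw [← div_le_iff₀' h6]
  linarith

theorem memLp_of_continuousOn {a b : ℝ} {f : ℝ → ℂ} (hf : ContinuousOn f (Set.Icc a b)) :
    MemLp f 2 (volume.restrict (Set.Ioo a b)) := by
  obtain ⟨C, hC⟩ := isCompact_Icc.exists_bound_of_continuousOn hf
  refine MemLp.of_bound ((hf.mono Set.Ioo_subset_Icc_self).aestronglyMeasurable measurableSet_Ioo)
    C ?_
  exact (ae_restrict_iff' measurableSet_Ioo).2
    (.of_forall fun x hx => hC x (Set.Ioo_subset_Icc_self hx))

theorem memLp_mul_continuous {a b : ℝ} {k g : ℝ → ℂ} (hk : Continuous k)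
    (hg : MemLp g 2 (volume.restrict (Set.Ioo a b))) :
    MemLp (fun x => k x * g x) 2 (volume.restrict (Set.Ioo a b)) := by
  obtain ⟨C, hC⟩ := isCompact_Icc.exists_bound_of_continuousOn (s := Set.Icc a b) hk.continuousOn
  refine hg.of_le_mul (c := C) (hk.aestronglyMeasurable.mul hg.1) ?_
  refine (ae_restrict_iff' measurableSet_Ioo).2 (.of_forall fun x hx => ?_)
  rw [norm_mul]
  gcongr
  exact hC x (Set.Ioo_subset_Icc_self hx)

/-- The inhomogeneous equation `-U'' - E U = g` on an edge, with prescribed boundary values. -/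
theorem exists_edge_solution {E : ℝ} (hS : sinE E Real.pi ≠ 0) :
    ∃ M, 0 ≤ M ∧ ∀ (a b : ℝ), b - a = Real.pi → ∀ g : ℝ → ℂ,
      MemLp g 2 (volume.restrict (Set.Ioo a b)) → ∀ p Q : ℂ, ∃ U V : ℝ → ℂ,
      IsPrimitive a b U V ∧ IsPrimitive a b V (fun x => -E * U x - g x) ∧ U a = p ∧ U b = Q ∧
      ∀ x ∈ Set.Icc a b, ‖U x‖ ≤ M * (‖p‖ + ‖Q‖ + ∫ x in Set.Ioo a b, ‖g x‖) := by
  obtain ⟨B₁, hB₁⟩ := isCompact_Icc.exists_bound_of_continuousOn (s := Set.Icc 0 Real.pi)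
    (continuous_cosE E).continuousOn
  obtain ⟨B₂, hB₂⟩ := isCompact_Icc.exists_bound_of_continuousOn (s := Set.Icc 0 Real.pi)
    (continuous_sinE E).continuousOn
  set B := max B₁ B₂ with hB
  have hBc : ∀ t ∈ Set.Icc 0 Real.pi, ‖(cosE E t : ℂ)‖ ≤ B := fun t ht => by
    rw [Complex.norm_real]; exact (hB₁ t ht).trans (le_max_left _ _)
  have hBs : ∀ t ∈ Set.Icc 0 Real.pi, ‖(sinE E t : ℂ)‖ ≤ B := fun t ht => by
    rw [Complex.norm_real]; exact (hB₂ t ht).trans (le_max_right _ _)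
  have hB0 : 0 ≤ B := (norm_nonneg _).trans (hBc 0 ⟨le_rfl, Real.pi_pos.le⟩)
  set σ : ℝ := ‖(sinE E Real.pi : ℂ)‖⁻¹ with hσ
  have hσ0 : 0 ≤ σ := by positivity
  have hSc : (sinE E Real.pi : ℂ) ≠ 0 := by exact_mod_cast hS
  refine ⟨B * (1 + B) + B * (σ * (1 + B * (1 + B)) + 2 * B), by positivity,
    fun a b hab g hg p Q => ?_⟩
  have hlt : a < b := by linarith [Real.pi_pos]
  have hle := hlt.le
  have hgi : IntervalIntegrable g volume a b := by
    rw [intervalIntegrable_iff_integrableOn_Ioo_of_le hle]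
    exact hg.integrable (by norm_num)
  have hcc : Continuous fun x : ℝ => (cosE E (x - a) : ℂ) := by
    have := continuous_cosE E
    fun_prop
  have hsc : Continuous fun x : ℝ => (sinE E (x - a) : ℂ) := by
    have := continuous_sinE E
    fun_prop
  set G := ∫ x in Set.Ioo a b, ‖g x‖ with hG
  have hG0 : 0 ≤ G := integral_nonneg fun x => norm_nonneg _
  let I₁ : ℝ → ℂ := fun x => ∫ t in a..x, (cosE E (t - a) : ℂ) * g t
  let I₂ : ℝ → ℂ := fun x => ∫ t in a..x, (sinE E (t - a) : ℂ) * g t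
  have hI : ∀ k : ℝ → ℂ, (∀ t ∈ Set.Icc a b, ‖k t‖ ≤ B) → ∀ x ∈ Set.Icc a b,
      ‖∫ t in a..x, k t * g t‖ ≤ B * G := fun k hk x hx => by
    rw [intervalIntegral.integral_of_le hx.1, integral_Ioc_eq_integral_Ioo]
    have hgn : IntegrableOn (fun t => B * ‖g t‖) (Set.Ioo a b) :=
      (hg.integrable (by norm_num)).norm.const_mul B
    have hsub : Set.Ioo a x ⊆ Set.Ioo a b := Set.Ioo_subset_Ioo_right hx.2
    calc ‖∫ t in Set.Ioo a x, k t * g t‖ ≤ ∫ t in Set.Ioo a x, B * ‖g t‖ := by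
          refine norm_integral_le_of_norm_le (hgn.mono_set hsub) ?_
          refine (ae_restrict_iff' measurableSet_Ioo).2 (.of_forall fun t ht => ?_)
          rw [norm_mul]
          gcongr
          exact hk t (Set.Ioo_subset_Icc_self (hsub ht))
      _ ≤ ∫ t in Set.Ioo a b, B * ‖g t‖ :=
          setIntegral_mono_set hgn (.of_forall fun t => by positivity) hsub.eventuallyLE
      _ = B * G := integral_const_mul _ _
  have hmem : ∀ x ∈ Set.Icc a b, x - a ∈ Set.Icc 0 Real.pi := fun x hx =>
    ⟨by linarith [hx.1], by linarith [hx.2]⟩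
  have hI₁ : ∀ x ∈ Set.Icc a b, ‖I₁ x‖ ≤ B * G := hI _ fun t ht => hBc _ (hmem t ht)
  have hI₂ : ∀ x ∈ Set.Icc a b, ‖I₂ x‖ ≤ B * G := hI _ fun t ht => hBs _ (hmem t ht)
  have hP₁ : IsPrimitive a b I₁ (fun t => (cosE E (t - a) : ℂ) * g t) :=
    IsPrimitive.of_integrable (hgi.continuousOn_mul hcc.continuousOn)
  have hP₂ : IsPrimitive a b I₂ (fun t => (sinE E (t - a) : ℂ) * g t) :=
    IsPrimitive.of_integrable (hgi.continuousOn_mul hsc.continuousOn)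
  have hC : IsPrimitive a b (fun x : ℝ => (cosE E (x - a) : ℂ)) _ :=
    IsPrimitive.of_hasDerivAt (hasDerivAt_cosE_sub E a) (by fun_prop)
  have hS' : IsPrimitive a b (fun x : ℝ => (sinE E (x - a) : ℂ)) _ :=
    IsPrimitive.of_hasDerivAt (hasDerivAt_sinE_sub E a) hcc
  -- Variation of constants: `v₀` is the initial slope, determined by the boundary value `Q` at `b`.
  -- This is where `sinE E π ≠ 0` is needed.
  set v₀ : ℂ := (Q - (p + I₂ b) * cosE E Real.pi) / sinE E Real.pi + I₁ b with hv₀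
  have hα := (IsPrimitive.const (a := a) (b := b) p).add hle hP₂
  have hβ := (IsPrimitive.const (a := a) (b := b) v₀).add hle (hP₁.const_mul (-1))
  have hsq : ∀ x : ℝ, (cosE E (x - a) : ℂ) ^ 2 + E * (sinE E (x - a) : ℂ) ^ 2 = 1 := fun x => by
    exact_mod_cast cosE_sq_add E (x - a)
  refine ⟨fun x => (p + I₂ x) * cosE E (x - a) + (v₀ + -1 * I₁ x) * sinE E (x - a),
    fun x => -E * ((p + I₂ x) * sinE E (x - a)) + (v₀ + -1 * I₁ x) * cosE E (x - a),
    ?_, ?_, ?_, ?_, ?_⟩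
  · refine ((hα.mul hle hC).add hle (hβ.mul hle hS')).congr (fun x => rfl) fun x => ?_
    ring
  · refine (((hα.mul hle hS').const_mul (-E)).add hle (hβ.mul hle hC)).congr (fun x => rfl)
      fun x => ?_
    linear_combination g x * hsq x
  · simp [I₁, I₂]
  · simp only [hab, hv₀]
    field_simp
    ring
  · intro x hx
    have hbm : b ∈ Set.Icc a b := Set.right_mem_Icc.2 hle
    have hpi : Real.pi ∈ Set.Icc 0 Real.pi := ⟨Real.pi_pos.le, le_rfl⟩
    set N := ‖p‖ + ‖Q‖ + G with hN
    have hN0 : 0 ≤ N := by positivity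
    have hα' : ∀ y ∈ Set.Icc a b, ‖p + I₂ y‖ ≤ (1 + B) * N := fun y hy => by
      have h1 := norm_add_le p (I₂ y)
      have h2 := hI₂ y hy
      have h3 : B * G ≤ B * N := by
        gcongr
        linarith [norm_nonneg p, norm_nonneg Q]
      have h4 : ‖p‖ ≤ N := by linarith [norm_nonneg Q]
      linarith
    have hv : ‖v₀‖ ≤ (σ * (1 + B * (1 + B)) + B) * N := by
      have h1 : ‖Q - (p + I₂ b) * cosE E Real.pi‖ ≤ N + (1 + B) * N * B := by
        refine (norm_sub_le _ _).trans ?_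
        rw [norm_mul]
        have h4 : ‖Q‖ ≤ N := by linarith [norm_nonneg p]
        have := hα' b hbm
        have := hBc _ hpi
        gcongr
      have h2 : ‖v₀‖ ≤ (N + (1 + B) * N * B) * σ + B * N := by
        refine (norm_add_le _ _).trans ?_
        rw [norm_div, div_eq_mul_inv]
        have h3 : B * G ≤ B * N := by
          gcongr
          linarith [norm_nonneg p, norm_nonneg Q]
        have h5 := (hI₁ b hbm).trans h3
        gcongr
      linarith
    have hβ' : ‖v₀ + -1 * I₁ x‖ ≤ (σ * (1 + B * (1 + B)) + 2 * B) * N := by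
      have h1 := norm_add_le v₀ (-1 * I₁ x)
      have h2 := hI₁ x hx
      have h3 : B * G ≤ B * N := by
        gcongr
        linarith [norm_nonneg p, norm_nonneg Q]
      have h4 : ‖-1 * I₁ x‖ = ‖I₁ x‖ := by simp
      linarith
    refine (norm_add_le _ _).trans ?_
    rw [norm_mul, norm_mul]
    have h5 := hBc _ (hmem x hx)
    have h6 := hBs _ (hmem x hx)
    have h7 := hα' x hx
    calc _ ≤ (1 + B) * N * B + (σ * (1 + B * (1 + B)) + 2 * B) * N * B := by gcongr
      _ = _ := by ring


section

/-! ### Decomposition of `L²(ℝ)` along the edges -/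

/-- The squared `L²` norm on the `j`-th edge. -/
def edgeSq (j : ℤ) (f : ℝ → ℂ) : ℝ := ∫ x in edge j, ‖f x‖ ^ 2

theorem edgeSq_nonneg (j : ℤ) (f : ℝ → ℂ) : 0 ≤ edgeSq j f :=
  integral_nonneg fun _ => sq_nonneg _

theorem edge_lt (j : ℤ) : (j : ℝ) * Real.pi < (j + 1) * Real.pi := by
  nlinarith [Real.pi_pos]

theorem edge_length (j : ℤ) : ((j : ℝ) + 1) * Real.pi - j * Real.pi = Real.pi := by ring

theorem measurableSet_edge (j : ℤ) : MeasurableSet (edge j) := measurableSet_Ioo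

instance (j : ℤ) : IsFiniteMeasure ((volume : Measure ℝ).restrict (edge j)) :=
  inferInstanceAs (IsFiniteMeasure ((volume : Measure ℝ).restrict (Set.Ioo _ _)))

theorem floor_eq_of_mem_edge {j : ℤ} {x : ℝ} (hx : x ∈ edge j) : ⌊x / Real.pi⌋ = j := by
  rw [Int.floor_eq_iff, le_div_iff₀ Real.pi_pos, div_lt_iff₀ Real.pi_pos]
  exact ⟨hx.1.le, hx.2⟩

theorem pairwise_disjoint_edge : Pairwise (Function.onFun Disjoint edge) := by
  intro i j hij
  refine Set.disjoint_left.2 fun x hi hj => hij ?_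
  rw [← floor_eq_of_mem_edge hi, floor_eq_of_mem_edge hj]

theorem iUnion_edge_ae : (⋃ j, edge j) =ᵐ[volume] Set.univ := by
  rw [ae_eq_univ]
  have : ∀ᵐ x ∂(volume : Measure ℝ), x ∈ ⋃ j, edge j :=
    ae_of_ae_edge fun j => (ae_restrict_iff' (measurableSet_edge j)).2
      (.of_forall fun x hx => Set.mem_iUnion.2 ⟨j, hx⟩)
  exact this

theorem restrict_iUnion_edge : (volume : Measure ℝ).restrict (⋃ j, edge j) = volume := by
  rw [Measure.restrict_congr_set iUnion_edge_ae, Measure.restrict_univ]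

theorem norm_sq_eq_integral (f : Lp ℂ 2 (volume : Measure ℝ)) : ‖f‖ ^ 2 = ∫ x, ‖f x‖ ^ 2 := by
  have h : ((‖f‖ ^ 2 : ℝ) : ℂ) = ((∫ x, ‖f x‖ ^ 2 : ℝ) : ℂ) := by
    rw [← integral_complex_ofReal]
    push_cast
    have h1 := inner_self_eq_norm_sq_to_K (𝕜 := ℂ) f
    rw [L2.inner_def] at h1
    simp only [inner_self_eq_norm_sq_to_K] at h1
    exact h1.symm
  exact_mod_cast h

theorem hasSum_edgeSq (f : Lp ℂ 2 (volume : Measure ℝ)) :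
    HasSum (fun j => edgeSq j f) (‖f‖ ^ 2) := by
  have hi : Integrable (fun x => ‖f x‖ ^ 2) volume :=
    (memLp_two_iff_integrable_sq_norm (Lp.memLp f).1).1 (Lp.memLp f)
  have := hasSum_integral_iUnion (μ := volume) measurableSet_edge pairwise_disjoint_edge
    hi.integrableOn
  rw [restrict_iUnion_edge] at this
  rw [norm_sq_eq_integral]
  exact this

theorem memLp_of_edge {f : ℝ → ℂ} (hf : ∀ j, MemLp f 2 (volume.restrict (edge j)))
    (hs : Summable fun j => edgeSq j f) : MemLp f 2 volume := by
  have hm : AEStronglyMeasurable f volume := by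
    rw [← restrict_iUnion_edge, aestronglyMeasurable_iUnion_iff]
    exact fun j => (hf j).1
  rw [memLp_two_iff_integrable_sq_norm hm, ← integrableOn_univ,
    ← integrableOn_congr_set_ae iUnion_edge_ae]
  refine integrableOn_iUnion_of_summable_integral_norm
    (fun j => (memLp_two_iff_integrable_sq_norm (hf j).1).1 (hf j)) (hs.congr fun j => ?_)
  simp [edgeSq]

theorem memLp_edge (f : Lp ℂ 2 (volume : Measure ℝ)) (j : ℤ) :
    MemLp f 2 (volume.restrict (edge j)) :=
  (Lp.memLp f).restrict _

theorem norm_sq_chain (f : L2Chain) : ‖f‖ ^ 2 = ∑ s, ‖f s‖ ^ 2 :=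
  PiLp.norm_sq_eq_of_L2 _ f

/-! ### Functionals supported on one edge -/

/-- The integral over the edge `(s, j)` against the profile `κ`, in the gauge of that edge. -/
def edgeInt (A : ℝ) (s : Bool) (κ : ℝ → ℝ) (j : ℤ) (f : ℝ → ℂ) : ℂ :=
  ∫ x in edge j, (κ (x - j * Real.pi) : ℂ) * (gauge (coeff A s) (j * Real.pi) x * f x)

theorem edgeInt_congr {A : ℝ} {s : Bool} {κ : ℝ → ℝ} {j : ℤ} {f g : ℝ → ℂ}
    (h : ∀ᵐ x ∂(volume.restrict (edge j)), f x = g x) :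
    edgeInt A s κ j f = edgeInt A s κ j g := by
  refine integral_congr_ae ?_
  filter_upwards [h] with x hx
  rw [hx]

theorem integrable_edgeInt {A : ℝ} {s : Bool} {κ : ℝ → ℝ} (hκ : Continuous κ) {j : ℤ} {f : ℝ → ℂ}
    (hf : MemLp f 2 (volume.restrict (edge j))) :
    Integrable (fun x => (κ (x - j * Real.pi) : ℂ) * (gauge (coeff A s) (j * Real.pi) x * f x))
      (volume.restrict (edge j)) := by
  have h1 := memLp_mul_continuous (continuous_gauge (coeff A s) (j * Real.pi)) hf
  have h2 := memLp_mul_continuous (k := fun x => (κ (x - j * Real.pi) : ℂ)) (by fun_prop) h1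
  exact h2.integrable (by norm_num)

/-- The gauge has modulus one and all edges are translates of one another, so one constant serves
all of them. This uniformity makes edge data square summable along the chain. -/
theorem exists_edgeInt_bound {κ : ℝ → ℝ} (hκ : Continuous κ) :
    ∃ K, 0 ≤ K ∧ ∀ A s j f, MemLp f 2 (volume.restrict (edge j)) →
      ‖edgeInt A s κ j f‖ ^ 2 ≤ K * edgeSq j f := by
  obtain ⟨B, hB⟩ := isCompact_Icc.exists_bound_of_continuousOn (s := Set.Icc 0 Real.pi)
    hκ.continuousOn
  have hB0 : 0 ≤ B := (norm_nonneg _).trans (hB 0 ⟨le_rfl, Real.pi_pos.le⟩)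
  refine ⟨B ^ 2 * Real.pi, by positivity, fun A s j f hf => ?_⟩
  have h1 : ‖edgeInt A s κ j f‖ ≤ B * ∫ x in edge j, ‖f x‖ := by
    rw [← integral_const_mul]
    refine norm_integral_le_of_norm_le ((hf.integrable (by norm_num)).norm.const_mul B) ?_
    refine (ae_restrict_iff' (measurableSet_edge j)).2 (.of_forall fun x hx => ?_)
    rw [norm_mul, norm_mul, norm_gauge_coeff, one_mul, Complex.norm_real]
    gcongr
    exact hB _ ⟨by linarith [hx.1], by linarith [hx.2]⟩
  have h2 := sq_integral_norm_le (edge_lt j) hf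
  rw [edge_length] at h2
  calc ‖edgeInt A s κ j f‖ ^ 2 ≤ (B * ∫ x in edge j, ‖f x‖) ^ 2 := by gcongr
    _ = B ^ 2 * (∫ x in edge j, ‖f x‖) ^ 2 := by ring
    _ ≤ B ^ 2 * (Real.pi * edgeSq j f) := by
        gcongr
        exact h2
    _ = _ := by ring

/-- `edgeInt` as a linear functional. -/
def edgeIntL (A : ℝ) (s : Bool) {κ : ℝ → ℝ} (hκ : Continuous κ) (j : ℤ) :
    Lp ℂ 2 (volume : Measure ℝ) →ₗ[ℂ] ℂ where
  toFun f := edgeInt A s κ j f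
  map_add' f g := by
    rw [edgeInt_congr (ae_restrict_of_ae (Lp.coeFn_add f g)), edgeInt, edgeInt, edgeInt,
      ← integral_add (integrable_edgeInt hκ (memLp_edge f j))
        (integrable_edgeInt hκ (memLp_edge g j))]
    refine integral_congr_ae (.of_forall fun x => ?_)
    simp only [Pi.add_apply]
    ring
  map_smul' c f := by
    rw [edgeInt_congr (ae_restrict_of_ae (Lp.coeFn_smul c f)), edgeInt, edgeInt, RingHom.id_apply,
      smul_eq_mul, ← integral_const_mul]
    refine integral_congr_ae (.of_forall fun x => ?_)
    simp only [Pi.smul_apply, smul_eq_mul]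
    ring

theorem edgeInt_eq_intervalIntegral (A : ℝ) (s : Bool) (κ : ℝ → ℝ) (j : ℤ) (f : ℝ → ℂ) :
    edgeInt A s κ j f = ∫ x in (j * Real.pi)..((j + 1) * Real.pi),
      (κ (x - j * Real.pi) : ℂ) * (gauge (coeff A s) (j * Real.pi) x * f x) := by
  rw [intervalIntegral.integral_of_le (edge_lt j).le, integral_Ioc_eq_integral_Ioo]
  rfl

/-! ### Boundary values on one edge -/

/-- `-𝒟²u`, in terms of the derivatives of `u`. -/
def magLap (c : ℂ) (u v w : ℝ → ℂ) (x : ℝ) : ℂ :=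
  -quasiDeriv c (quasiDeriv c u v) (quasiDeriv c v w) x

/-- The phase that is accumulated along a semicircle. -/
def phase (A : ℝ) (s : Bool) : ℂ := Complex.exp (coeff A s * Real.pi)

theorem gauge_right (A : ℝ) (s : Bool) (j : ℤ) :
    gauge (coeff A s) (j * Real.pi) ((j + 1) * Real.pi) = phase A s := by
  rw [gauge, edge_length, phase]

theorem phase_ne_zero (A : ℝ) (s : Bool) : phase A s ≠ 0 := Complex.exp_ne_zero _

theorem phase_mul (A : ℝ) : phase A true * phase A false = 1 := by
  rw [phase, phase, ← Complex.exp_add]; simp [coeff]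

/-- The two semicircles carry conjugate phases `exp (± i A π)`; their sum is the coupling `c`
between neighbouring sites. -/
theorem phase_add (A : ℝ) : phase A true + phase A false = (2 * Real.cos (A * Real.pi) : ℝ) := by
  push_cast
  rw [Complex.cos, phase, phase]
  simp only [coeff, if_true, Bool.false_eq_true, if_false]
  ring_nf

theorem HasSobolevDerivs.gauge_primitives {j : ℤ} {c : ℂ} {u v w : ℝ → ℂ}
    (h : HasSobolevDerivs (j * Real.pi) ((j + 1) * Real.pi) u v w) :
    IsPrimitive (j * Real.pi) ((j + 1) * Real.pi) (fun x => gauge c (j * Real.pi) x * u x)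
        (fun x => gauge c (j * Real.pi) x * quasiDeriv c u v x) ∧
      IsPrimitive (j * Real.pi) ((j + 1) * Real.pi)
        (fun x => gauge c (j * Real.pi) x * quasiDeriv c u v x)
        (fun x => -(gauge c (j * Real.pi) x * magLap c u v w x)) := by
  have hab := (edge_lt j).le
  obtain ⟨h1, h2⟩ := h.isPrimitive hab
  refine ⟨h1.gauge_mul hab c, ((h1.quasiDeriv hab c h2).gauge_mul hab c).congr (fun x => rfl)
    fun x => ?_⟩
  simp only [magLap]
  ring

variable {A E : ℝ} {s : Bool} {j : ℤ} {u v w f : ℝ → ℂ}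

/-- Testing with the solution that vanishes at the right endpoint eliminates the flux there.
Together with `flux_right`, this is the Dirichlet-to-Neumann map of an edge with an inhomogeneity.
-/
theorem HasSobolevDerivs.flux_left
    (h : HasSobolevDerivs (j * Real.pi) ((j + 1) * Real.pi) u v w)
    (hf : ∀ᵐ x ∂(volume.restrict (edge j)), f x = magLap (coeff A s) u v w x - E * u x) :
    sinE E Real.pi * quasiDeriv (coeff A s) u v (j * Real.pi) =
      phase A s * u ((j + 1) * Real.pi) - cosE E Real.pi * u (j * Real.pi) +
        edgeInt A s (fun t => sinE E (Real.pi - t)) j f := by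
  obtain ⟨h1, h2⟩ := h.gauge_primitives (c := coeff A s)
  have := green_sinE_right (E := E) (edge_lt j).le h1 h2
  rw [edge_length, gauge_self, gauge_right, one_mul, one_mul] at this
  rw [edgeInt_congr hf, edgeInt_eq_intervalIntegral]
  have h3 : ∫ x in (j * Real.pi)..((j + 1) * Real.pi),
      (sinE E (Real.pi - (x - j * Real.pi)) : ℂ) * (gauge (coeff A s) (j * Real.pi) x *
        (magLap (coeff A s) u v w x - E * u x)) =
      -∫ x in (j * Real.pi)..((j + 1) * Real.pi), (sinE E ((j + 1) * Real.pi - x) : ℂ) *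
        (-(gauge (coeff A s) (j * Real.pi) x * magLap (coeff A s) u v w x) +
          E * (gauge (coeff A s) (j * Real.pi) x * u x)) := by
    rw [← intervalIntegral.integral_neg]
    refine intervalIntegral.integral_congr fun x _ => ?_
    rw [show Real.pi - (x - j * Real.pi) = (j + 1) * Real.pi - x by ring]
    ring
  rw [h3, this]
  ring

theorem HasSobolevDerivs.flux_right
    (h : HasSobolevDerivs (j * Real.pi) ((j + 1) * Real.pi) u v w)
    (hf : ∀ᵐ x ∂(volume.restrict (edge j)), f x = magLap (coeff A s) u v w x - E * u x) :
    sinE E Real.pi * quasiDeriv (coeff A s) u v ((j + 1) * Real.pi) =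
      cosE E Real.pi * u ((j + 1) * Real.pi) - (phase A s)⁻¹ * u (j * Real.pi) -
        (phase A s)⁻¹ * edgeInt A s (sinE E) j f := by
  obtain ⟨h1, h2⟩ := h.gauge_primitives (c := coeff A s)
  have := green_sinE_left (E := E) (edge_lt j).le h1 h2
  rw [edge_length, gauge_self, gauge_right, one_mul] at this
  rw [edgeInt_congr hf, edgeInt_eq_intervalIntegral]
  have h3 : ∫ x in (j * Real.pi)..((j + 1) * Real.pi),
      (sinE E (x - j * Real.pi) : ℂ) * (gauge (coeff A s) (j * Real.pi) x *
        (magLap (coeff A s) u v w x - E * u x)) =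
      -∫ x in (j * Real.pi)..((j + 1) * Real.pi), (sinE E (x - j * Real.pi) : ℂ) *
        (-(gauge (coeff A s) (j * Real.pi) x * magLap (coeff A s) u v w x) +
          E * (gauge (coeff A s) (j * Real.pi) x * u x)) := by
    rw [← intervalIntegral.integral_neg]
    refine intervalIntegral.integral_congr fun x _ => ?_
    ring
  rw [h3, this]
  have := phase_ne_zero A s
  field_simp
  ring

/-- A cubic profile that singles out the boundary value at the left endpoint. -/
def traceProfile (t : ℝ) : ℝ := t * (Real.pi - t) ^ 2 / Real.pi ^ 2

/-- The second derivative of `traceProfile`. -/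
def traceProfile'' (t : ℝ) : ℝ := (6 * t - 4 * Real.pi) / Real.pi ^ 2

theorem continuous_traceProfile : Continuous traceProfile := by
  unfold traceProfile; fun_prop

theorem continuous_traceProfile'' : Continuous traceProfile'' := by
  unfold traceProfile''; fun_prop

/-- Both endpoint values of the profile and its slope at `π` vanish, while its slope at `0` is `1`,
so Green's formula leaves only `u` at the left vertex. A vertex value thus becomes a functional of a
function and its image, independent of any energy. -/
theorem HasSobolevDerivs.trace_left
    (h : HasSobolevDerivs (j * Real.pi) ((j + 1) * Real.pi) u v w) :
    u (j * Real.pi) = -edgeInt A s traceProfile j (magLap (coeff A s) u v w)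
      - edgeInt A s traceProfile'' j u := by
  obtain ⟨h1, h2⟩ := h.gauge_primitives (c := coeff A s)
  let χ' : ℝ → ℝ := fun t => ((Real.pi - t) ^ 2 - 2 * t * (Real.pi - t)) / Real.pi ^ 2
  have hχ : ∀ t, HasDerivAt traceProfile (χ' t) t := fun t => by
    have := (((hasDerivAt_id' t).mul (((hasDerivAt_id' t).const_sub Real.pi).pow 2)).div_const
      (Real.pi ^ 2))
    convert! this using 1
    simp [χ']; ring
  have hχ' : ∀ t, HasDerivAt χ' (traceProfile'' t) t := fun t => by
    have := ((((hasDerivAt_id' t).const_sub Real.pi).pow 2).sub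
      (((hasDerivAt_id' t).const_mul 2).mul ((hasDerivAt_id' t).const_sub Real.pi))).div_const
      (Real.pi ^ 2)
    convert! this using 1
    simp [traceProfile'']; ring
  have hcont := continuous_traceProfile''
  have := green (edge_lt j).le h1 h2
    (χ := fun x => (traceProfile (x - j * Real.pi) : ℂ)) (χ' := fun x => (χ' (x - j * Real.pi) : ℂ))
    (χ'' := fun x => (traceProfile'' (x - j * Real.pi) : ℂ))
    (fun x => ((hχ _).comp_sub_const x _).ofReal_comp)
    (fun x => ((hχ' _).comp_sub_const x _).ofReal_comp) (by fun_prop)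
  have e1 : χ' 0 = 1 := by simp [χ', Real.pi_ne_zero]
  have e2 : χ' Real.pi = 0 := by simp [χ']
  have e3 : traceProfile 0 = 0 := by simp [traceProfile]
  have e4 : traceProfile Real.pi = 0 := by simp [traceProfile]
  have hu : MemLp u 2 (volume.restrict (edge j)) :=
    memLp_of_continuousOn (h.continuousOn (edge_lt j).le)
  have hw : MemLp (magLap (coeff A s) u v w) 2 (volume.restrict (edge j)) := by
    have hv : MemLp v 2 (volume.restrict (edge j)) :=
      memLp_of_continuousOn (h.continuousOn_deriv (edge_lt j).le)
    exact ((h.memLp.add (hv.const_mul _)).add ((hv.add (hu.const_mul _)).const_mul _)).neg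
  simp only [edge_length, sub_self, e1, e2, e3, e4, gauge_self] at this
  have h5 : u (j * Real.pi) = (0 : ℝ) * (gauge (coeff A s) (j * Real.pi) ((j + 1) * Real.pi) *
      quasiDeriv (coeff A s) u v ((j + 1) * Real.pi)) -
      (0 : ℝ) * (gauge (coeff A s) (j * Real.pi) ((j + 1) * Real.pi) * u ((j + 1) * Real.pi)) -
      ((0 : ℝ) * (1 * quasiDeriv (coeff A s) u v (j * Real.pi)) -
        (1 : ℝ) * (1 * u (j * Real.pi))) := by push_cast; ring
  have hi : Integrable (fun x => -((traceProfile (x - j * Real.pi) : ℂ) *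
      (gauge (coeff A s) (j * Real.pi) x * magLap (coeff A s) u v w x)))
      (volume.restrict (edge j)) := (integrable_edgeInt continuous_traceProfile hw).neg
  rw [h5, ← this, intervalIntegral.integral_of_le (edge_lt j).le, integral_Ioc_eq_integral_Ioo,
    edgeInt, edgeInt, ← integral_neg, ← integral_sub hi
    (integrable_edgeInt continuous_traceProfile'' hu)]
  refine integral_congr_ae (.of_forall fun x => ?_)
  ring

end


section

/-! ### Reduction of the chain graph to a Jacobi equation -/

/-- The right-hand side of the Jacobi equation for the vertex values. -/
def source (A E : ℝ) (f : Bool → ℝ → ℂ) (j : ℤ) : ℂ :=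
  edgeInt A true (fun t => sinE E (Real.pi - t)) j (f true) +
    edgeInt A false (fun t => sinE E (Real.pi - t)) j (f false) +
    ((phase A true)⁻¹ * edgeInt A true (sinE E) (j - 1) (f true) +
    (phase A false)⁻¹ * edgeInt A false (sinE E) (j - 1) (f false))

theorem vertex_identity {A E : ℝ} {f : Bool → ℝ → ℂ} {u v w : Bool → ℤ → ℝ → ℂ} {q : ℤ → ℂ}
    (hs : ∀ s (j : ℤ),
      HasSobolevDerivs (j * Real.pi) ((j + 1) * Real.pi) (u s j) (v s j) (w s j))
    (hf : ∀ s j, ∀ᵐ x ∂(volume.restrict (edge j)),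
      f s x = magLap (coeff A s) (u s j) (v s j) (w s j) x - E * u s j x)
    (hl : ∀ s j, u s j (j * Real.pi) = q j) (hr : ∀ s j, u s j ((j + 1) * Real.pi) = q (j + 1))
    (j : ℤ) :
    sinE E Real.pi * (quasiDeriv (coeff A true) (u true j) (v true j) (j * Real.pi)
      + quasiDeriv (coeff A false) (u false j) (v false j) (j * Real.pi)
      - quasiDeriv (coeff A true) (u true (j - 1)) (v true (j - 1)) (j * Real.pi)
      - quasiDeriv (coeff A false) (u false (j - 1)) (v false (j - 1)) (j * Real.pi)) =
    (2 * Real.cos (A * Real.pi) : ℝ) * (q (j + 1) + q (j - 1)) - 4 * cosE E Real.pi * q j +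
      source A E f j := by
  have e : (((j - 1 : ℤ) : ℝ) + 1) * Real.pi = j * Real.pi := by push_cast; ring
  have l1 := (hs true j).flux_left (hf true j)
  have l2 := (hs false j).flux_left (hf false j)
  have r1 := (hs true (j - 1)).flux_right (hf true (j - 1))
  have r2 := (hs false (j - 1)).flux_right (hf false (j - 1))
  rw [hl, hr] at l1 l2 r1 r2
  rw [e, sub_add_cancel] at r1 r2
  rw [← phase_add]
  -- The phases of the two semicircles are reciprocal, so transport to the left and to the right
  -- gives the same sum `2 cos (A π)`.
  have hi : (phase A false)⁻¹ = phase A true := (eq_inv_of_mul_eq_one_left (phase_mul A)).symm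
  have hi' : (phase A true)⁻¹ = phase A false := by rw [← hi, inv_inv]
  simp only [source]
  rw [hi'] at r1
  rw [hi] at r2
  rw [hi, hi']
  linear_combination l1 + l2 - r1 - r2

variable {A E : ℝ} {β : ℤ → ℝ} {ψ η : L2Chain} {u v w : Bool → ℤ → ℝ → ℂ}

namespace IsWaveFunction

theorem left_value (h : IsWaveFunction A β ψ η u v w) (s : Bool) (j : ℤ) :
    u s j (j * Real.pi) = u true j (j * Real.pi) := by
  cases s
  · exact h.cont_lower j
  · rfl

theorem right_value (h : IsWaveFunction A β ψ η u v w) (s : Bool) (j : ℤ) :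
    u s j ((j + 1) * Real.pi) = u true (j + 1) ((j + 1 : ℤ) * Real.pi) := by
  have := h.cont_left s (j + 1)
  rw [add_sub_cancel_right] at this
  rw [← this]
  push_cast
  rfl

theorem residual (h : IsWaveFunction A β ψ η u v w) (E : ℝ) (s : Bool) (j : ℤ) :
    ∀ᵐ x ∂(volume.restrict (edge j)), ((η - (E : ℂ) • ψ) s : ℝ → ℂ) x =
      magLap (coeff A s) (u s j) (v s j) (w s j) x - E * u s j x := by
  filter_upwards [h.ae_eq s j, h.action s j, ae_restrict_of_ae (Lp.coeFn_sub (η s) ((E : ℂ) • ψ s)),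
    ae_restrict_of_ae (Lp.coeFn_smul (E : ℂ) (ψ s))] with x h1 h2 h3 h4
  rw [PiLp.sub_apply, PiLp.smul_apply, h3, Pi.sub_apply, h4, Pi.smul_apply, h1, h2]
  rfl

/-- The δ-condition replaces the flux balance in `vertex_identity` by `β j` times the vertex value,
which completes the diagonal entry to `disc (β j) E`. -/
theorem jacobi (h : IsWaveFunction A β ψ η u v w) (E : ℝ) (j : ℤ) :
    disc (β j) E * u true j (j * Real.pi) - (2 * Real.cos (A * Real.pi) : ℝ) *
      (u true (j + 1) ((j + 1 : ℤ) * Real.pi) + u true (j - 1) ((j - 1 : ℤ) * Real.pi)) =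
      source A E (fun s => ((η - (E : ℂ) • ψ) s : ℝ → ℂ)) j := by
  have := vertex_identity (q := fun j => u true j (j * Real.pi)) h.sobolev (h.residual E)
    h.left_value h.right_value j
  rw [h.delta] at this
  simp only [disc]
  push_cast at this ⊢
  linear_combination this

/-- A wave function with zero vertex values and vanishing residual is zero. -/
theorem eq_zero (h : IsWaveFunction A β ψ η u v w) (hS : sinE E Real.pi ≠ 0)
    (hη : η = (E : ℂ) • ψ) (hq : ∀ j : ℤ, u true j (j * Real.pi) = 0) : ψ = 0 := by
  ext s
  refine ae_of_ae_edge fun j => ?_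
  obtain ⟨h1, h2⟩ := (h.sobolev s j).gauge_primitives (c := coeff A s)
  have h0 := edge_unique (E := E) (edge_lt j).le (by rwa [edge_length]) h1 h2 (by
    filter_upwards [h.residual E s j, ae_restrict_of_ae (Lp.coeFn_zero ℂ 2 (volume : Measure ℝ))]
      with x hx hx0
    have h3 : (η - (E : ℂ) • ψ) s = 0 := by rw [hη, sub_self]; rfl
    rw [h3, hx0, Pi.zero_apply] at hx
    linear_combination gauge (coeff A s) (j * Real.pi) x * hx)
    (by rw [h.left_value, hq, mul_zero]) (by rw [h.right_value, hq, mul_zero])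
  filter_upwards [h.ae_eq s j, ae_restrict_of_ae (Lp.coeFn_zero ℂ 2 (volume : Measure ℝ)),
    ae_restrict_mem (measurableSet_edge j)] with x h3 h4 hx
  have h5 := h0 x (Set.Ioo_subset_Icc_self hx)
  rw [h3]
  refine Eq.trans ?_ h4.symm
  exact (mul_eq_zero.1 h5).resolve_left (Complex.exp_ne_zero _)

end IsWaveFunction

/-- The value at the vertex `jπ`, as a linear functional of a wave function and its image. -/
def traceMap (A : ℝ) (j : ℤ) : L2Chain × L2Chain →ₗ[ℂ] ℂ where
  toFun p := -edgeIntL A true continuous_traceProfile j (p.2 true)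
    - edgeIntL A true continuous_traceProfile'' j (p.1 true)
  map_add' p q := by
    simp only [Prod.fst_add, Prod.snd_add, PiLp.add_apply, map_add]; ring
  map_smul' c p := by
    simp only [Prod.smul_fst, Prod.smul_snd, PiLp.smul_apply, map_smul, smul_eq_mul,
      RingHom.id_apply]
    ring

/-- Vertex values depend only on the `L²` classes of `ψ` and `η`, not on representatives or
couplings. They can therefore serve as linear constraints common to both operators. -/
theorem IsWaveFunction.trace (h : IsWaveFunction A β ψ η u v w) (j : ℤ) :
    u true j (j * Real.pi) = traceMap A j (ψ, η) := by
  rw [(h.sobolev true j).trace_left (A := A) (s := true)]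
  change _ = -edgeInt A true _ j (η true) - edgeInt A true _ j (ψ true)
  rw [edgeInt_congr (h.action true j), edgeInt_congr (h.ae_eq true j)]
  rfl

theorem summable_trace (A : ℝ) (p : L2Chain × L2Chain) :
    Summable fun j => ‖traceMap A j p‖ ^ 2 := by
  obtain ⟨K₁, hK₁, h₁⟩ := exists_edgeInt_bound continuous_traceProfile
  obtain ⟨K₂, hK₂, h₂⟩ := exists_edgeInt_bound continuous_traceProfile''
  refine Summable.of_nonneg_of_le (fun j => by positivity) (fun j => ?_)
    ((((hasSum_edgeSq (p.2 true)).summable.mul_left K₁).add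
      ((hasSum_edgeSq (p.1 true)).summable.mul_left K₂)).mul_left 2)
  have h3 := h₁ A true j (p.2 true) (memLp_edge _ j)
  have h4 := h₂ A true j (p.1 true) (memLp_edge _ j)
  have h5 := norm_add_sq_le_two_mul (-edgeInt A true traceProfile j (p.2 true))
    (-edgeInt A true traceProfile'' j (p.1 true))
  rw [norm_neg, norm_neg, ← sub_eq_add_neg] at h5
  exact h5.trans (by linarith)

theorem exists_source_bound (E : ℝ) : ∃ K, 0 ≤ K ∧ ∀ (A : ℝ) (f : L2Chain),
    (Summable fun j => ‖source A E (fun s => f s) j‖ ^ 2) ∧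
      ∑' j, ‖source A E (fun s => f s) j‖ ^ 2 ≤ K * ‖f‖ ^ 2 := by
  have hc := continuous_sinE E
  obtain ⟨K₁, hK₁, h₁⟩ := exists_edgeInt_bound
    (show Continuous fun t => sinE E (Real.pi - t) by fun_prop)
  obtain ⟨K₂, hK₂, h₂⟩ := exists_edgeInt_bound hc
  refine ⟨4 * (K₁ + K₂), by positivity, fun A f => ?_⟩
  have hs := fun s => hasSum_edgeSq (f s)
  have hs' : ∀ s, HasSum (fun j => edgeSq (j - 1) (f s)) (‖f s‖ ^ 2) := fun s =>
    (Equiv.subRight (1 : ℤ)).hasSum_iff.2 (hs s)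
  have hsum := ((((hs true).mul_left K₁).add ((hs false).mul_left K₁)).add
    (((hs' true).mul_left K₂).add ((hs' false).mul_left K₂))).mul_left 4
  have hinv : ∀ s, ‖(phase A s)⁻¹‖ = 1 := fun s => by
    rw [norm_inv, ← gauge_right A s 0, norm_gauge_coeff, inv_one]
  have hle : ∀ j, ‖source A E (fun s => f s) j‖ ^ 2 ≤
      4 * (K₁ * edgeSq j (f true) + K₁ * edgeSq j (f false) +
        (K₂ * edgeSq (j - 1) (f true) + K₂ * edgeSq (j - 1) (f false))) := fun j => by
    have h3 := h₁ A true j (f true) (memLp_edge _ j)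
    have h4 := h₁ A false j (f false) (memLp_edge _ j)
    have h5 := h₂ A true (j - 1) (f true) (memLp_edge _ _)
    have h6 := h₂ A false (j - 1) (f false) (memLp_edge _ _)
    simp only [source]
    refine (norm_add_sq_le_two_mul _ _).trans ?_
    have h7 := norm_add_sq_le_two_mul (edgeInt A true (fun t => sinE E (Real.pi - t)) j (f true))
      (edgeInt A false (fun t => sinE E (Real.pi - t)) j (f false))
    have h8 := norm_add_sq_le_two_mul ((phase A true)⁻¹ * edgeInt A true (sinE E) (j - 1) (f true))
      ((phase A false)⁻¹ * edgeInt A false (sinE E) (j - 1) (f false))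
    rw [norm_mul, norm_mul, hinv, hinv, one_mul, one_mul] at h8
    linarith
  have hsm := hsum.summable.of_nonneg_of_le (fun j => by positivity) hle
  refine ⟨hsm, (hsm.tsum_le_tsum hle hsum.summable).trans_eq ?_⟩
  rw [hsum.tsum_eq, norm_sq_chain]
  simp only [Fintype.sum_bool]
  ring

theorem add_add_sq_le (a b c : ℝ) : (a + b + c) ^ 2 ≤ 3 * (a ^ 2 + b ^ 2 + c ^ 2) := by
  nlinarith [sq_nonneg (a - b), sq_nonneg (b - c), sq_nonneg (a - c)]

/-- The solution on one edge with prescribed boundary values, in the original gauge. -/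
theorem exists_edge_wave {E : ℝ} (hS : sinE E Real.pi ≠ 0) :
    ∃ M, 0 ≤ M ∧ ∀ (A : ℝ) (s : Bool) (j : ℤ) (f : ℝ → ℂ),
      MemLp f 2 (volume.restrict (edge j)) → ∀ p Q : ℂ, ∃ u v w : ℝ → ℂ,
      HasSobolevDerivs (j * Real.pi) ((j + 1) * Real.pi) u v w ∧
      (∀ x, f x = magLap (coeff A s) u v w x - E * u x) ∧
      u (j * Real.pi) = p ∧ u ((j + 1) * Real.pi) = Q ∧
      ∀ x ∈ edge j, ‖u x‖ ^ 2 ≤ M * (‖p‖ ^ 2 + ‖Q‖ ^ 2 + edgeSq j f) := by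
  obtain ⟨M, hM, H⟩ := exists_edge_solution hS
  -- The `3` comes from squaring a sum of three terms, the `π` from Cauchy–Schwarz on an edge of
  -- length `π`.
  refine ⟨M ^ 2 * (3 * Real.pi), by positivity, fun A s j f hf p Q => ?_⟩
  set a : ℝ := j * Real.pi with ha
  set b : ℝ := (j + 1) * Real.pi with hb
  have hab : a ≤ b := (edge_lt j).le
  set c := coeff A s with hc
  have hf : MemLp f 2 (volume.restrict (Set.Ioo a b)) := hf
  have hg := memLp_mul_continuous (continuous_gauge c a) hf
  -- The equation is solved without potential, with the right boundary value carrying the phase, and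
  -- then gauged back by `-c`.
  obtain ⟨U, V, hU, hV, hUa, hUb, hbd⟩ := H a b (edge_length j) _ hg p (gauge c a b * Q)
  have hP := hU.gauge_mul hab (-c)
  have hP' := (hU.quasiDeriv hab (-c) hV).gauge_mul hab (-c)
  have hUL := memLp_of_continuousOn (hU.continuousOn hab)
  have hVL := memLp_of_continuousOn (hV.continuousOn hab)
  have hWL : MemLp (fun x => -(E : ℂ) * U x - gauge c a x * f x) 2 (volume.restrict (Set.Ioo a b)) :=
    (hUL.const_mul _).sub hg
  refine ⟨_, _, _, ⟨?_, hP'.eq, hP.eq⟩, fun x => ?_, ?_, ?_, fun x hx => ?_⟩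
  · exact memLp_mul_continuous (continuous_gauge (-c) a)
      ((hWL.add (hVL.const_mul _)).add ((hVL.add (hUL.const_mul _)).const_mul _))
  · simp only [magLap, quasiDeriv]
    linear_combination (-f x) * gauge_neg_mul c a x
  · simp [hUa]
  · rw [hUb, ← mul_assoc, gauge_neg_mul, one_mul]
  · have h1 := hbd x (Set.Ioo_subset_Icc_self hx)
    have h2 := sq_integral_norm_le (edge_lt j) hf
    rw [edge_length] at h2
    simp only [norm_mul, hc, norm_gauge_coeff, norm_gauge_neg_coeff, one_mul] at h1 ⊢
    calc ‖U x‖ ^ 2 ≤ (M * (‖p‖ + ‖Q‖ + ∫ x in Set.Ioo a b, ‖f x‖)) ^ 2 := by gcongr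
      _ = M ^ 2 * (‖p‖ + ‖Q‖ + ∫ x in Set.Ioo a b, ‖f x‖) ^ 2 := by ring
      _ ≤ M ^ 2 * (3 * (‖p‖ ^ 2 + ‖Q‖ ^ 2 + (∫ x in Set.Ioo a b, ‖f x‖) ^ 2)) := by
          gcongr
          exact add_add_sq_le _ _ _
      _ ≤ M ^ 2 * (3 * (Real.pi * ‖p‖ ^ 2 + Real.pi * ‖Q‖ ^ 2 + Real.pi * edgeSq j f)) := by
          have h3 : 1 ≤ Real.pi := by linarith [Real.pi_gt_three]
          gcongr
          · nlinarith [sq_nonneg ‖p‖]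
          · nlinarith [sq_nonneg ‖Q‖]
          · exact h2
      _ = _ := by ring

/-- Every `ℓ²` solution of the Jacobi equation comes from a wave function. -/
theorem exists_wave {E : ℝ} (hS : sinE E Real.pi ≠ 0) :
    ∃ M, 0 ≤ M ∧ ∀ (A : ℝ) (β : ℤ → ℝ) (f : L2Chain) (q : ℤ → ℂ), (Summable fun j => ‖q j‖ ^ 2) →
      (∀ j, disc (β j) E * q j - (2 * Real.cos (A * Real.pi) : ℝ) * (q (j + 1) + q (j - 1)) =
        source A E (fun s => f s) j) →
      ∃ (ψ : L2Chain) (u v w : Bool → ℤ → ℝ → ℂ),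
        IsWaveFunction A β ψ (f + (E : ℂ) • ψ) u v w ∧ (∀ j : ℤ, u true j (j * Real.pi) = q j) ∧
        ‖ψ‖ ^ 2 ≤ M * (∑' j, ‖q j‖ ^ 2 + ‖f‖ ^ 2) := by
  obtain ⟨M, hM, H⟩ := exists_edge_wave hS
  refine ⟨4 * (Real.pi * M), by positivity, fun A β f q hq hj => ?_⟩
  have h := fun (s : Bool) (j : ℤ) => H A s j (f s) (memLp_edge _ j) (q j) (q (j + 1))
  choose u v w hs hf hl hr hbd using h
  -- Gluing along the edges; the values at the vertices form a null set.
  let g : Bool → ℝ → ℂ := fun s x => u s ⌊x / Real.pi⌋ x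
  have hgu : ∀ s j, ∀ x ∈ edge j, g s x = u s j x := fun s j x hx => by
    simp only [g, floor_eq_of_mem_edge hx]
  have hgae : ∀ s j, g s =ᵐ[volume.restrict (edge j)] u s j := fun s j =>
    (ae_restrict_iff' (measurableSet_edge j)).2 (.of_forall (hgu s j))
  have huL : ∀ s j, MemLp (u s j) 2 (volume.restrict (edge j)) := fun s j =>
    memLp_of_continuousOn ((hs s j).continuousOn (edge_lt j).le)
  have hgL : ∀ s j, MemLp (g s) 2 (volume.restrict (edge j)) := fun s j =>
    (memLp_congr_ae (hgae s j)).2 (huL s j)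
  have hle : ∀ s j, edgeSq j (g s) ≤
      Real.pi * M * (‖q j‖ ^ 2 + ‖q (j + 1)‖ ^ 2 + edgeSq j (f s)) := fun s j => by
    have h1 : edgeSq j (g s) ≤ ∫ x in edge j, M * (‖q j‖ ^ 2 + ‖q (j + 1)‖ ^ 2 + edgeSq j (f s)) := by
      refine setIntegral_mono_on ((memLp_two_iff_integrable_sq_norm (hgL s j).1).1 (hgL s j))
        (integrable_const _) (measurableSet_edge j) fun x hx => ?_
      rw [hgu s j x hx]
      exact hbd s j x hx
    refine h1.trans_eq ?_
    rw [integral_const]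
    simp only [edge, measureReal_restrict_apply_univ, Real.volume_real_Ioo_of_le (edge_lt j).le,
      edge_length, smul_eq_mul]
    ring
  have hsum : ∀ s, HasSum (fun j => Real.pi * M * (‖q j‖ ^ 2 + ‖q (j + 1)‖ ^ 2 + edgeSq j (f s)))
      (Real.pi * M * (∑' j, ‖q j‖ ^ 2 + ∑' j, ‖q j‖ ^ 2 + ‖f s‖ ^ 2)) := fun s => by
    have h1 : HasSum (fun j => ‖q (j + 1)‖ ^ 2) (∑' j, ‖q j‖ ^ 2) :=
      (Equiv.addRight (1 : ℤ)).hasSum_iff.2 hq.hasSum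
    exact ((hq.hasSum.add h1).add (hasSum_edgeSq (f s))).mul_left _
  have hgs : ∀ s, Summable fun j => edgeSq j (g s) := fun s =>
    (hsum s).summable.of_nonneg_of_le (fun j => edgeSq_nonneg _ _) (hle s)
  have hg : ∀ s, MemLp (g s) 2 volume := fun s => memLp_of_edge (hgL s) (hgs s)
  let ψ : L2Chain := WithLp.toLp 2 fun s => (hg s).toLp
  have hψ : ∀ s j, ∀ᵐ x ∂(volume.restrict (edge j)), (ψ s : ℝ → ℂ) x = u s j x := fun s j => by
    filter_upwards [ae_restrict_of_ae (hg s).coeFn_toLp, hgae s j] with x h1 h2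
    exact h1.trans h2
  refine ⟨ψ, u, v, w, ⟨hs, hψ, fun s j => ?_, fun j => ?_, fun s j => ?_, fun j => ?_⟩,
    hl true, ?_⟩
  · filter_upwards [hψ s j, ae_restrict_of_ae (Lp.coeFn_add (f s) ((E : ℂ) • ψ s)),
      ae_restrict_of_ae (Lp.coeFn_smul (E : ℂ) (ψ s))] with x h1 h2 h3
    rw [PiLp.add_apply, PiLp.smul_apply, h2, Pi.add_apply, h3, Pi.smul_apply, h1, hf s j x, magLap,
      smul_eq_mul]
    ring
  · rw [hl, hl]
  · have h1 := hr s (j - 1)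
    rw [show (((j - 1 : ℤ) : ℝ) + 1) * Real.pi = j * Real.pi by push_cast; ring,
      sub_add_cancel] at h1
    rw [h1, hl]
  -- The Jacobi equation is the δ-condition multiplied by `sinE E π`, which is nonzero.
  · have h1 := vertex_identity (A := A) (E := E) (f := fun s => f s) hs
      (fun s j => .of_forall (hf s j)) hl hr j
    have h2 : (sinE E Real.pi : ℂ) ≠ 0 := by exact_mod_cast hS
    refine mul_left_cancel₀ h2 ?_
    rw [h1, ← hj j, hl]
    simp only [disc]
    push_cast
    ring
  · have h1 : ∀ s, ‖ψ s‖ ^ 2 ≤ Real.pi * M * (∑' j, ‖q j‖ ^ 2 + ∑' j, ‖q j‖ ^ 2 + ‖f s‖ ^ 2) :=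
      fun s => by
        refine hasSum_le (fun j => ?_) (hasSum_edgeSq (ψ s)) (hsum s)
        refine (le_of_eq ?_).trans (hle s j)
        refine integral_congr_ae ?_
        filter_upwards [hψ s j, hgae s j] with x h2 h3
        rw [h2, h3]
    have h2 : 0 ≤ ∑' j, ‖q j‖ ^ 2 := tsum_nonneg fun j => by positivity
    rw [norm_sq_chain, norm_sq_chain, Fintype.sum_bool, Fintype.sum_bool]
    have h3 := h1 true
    have h4 := h1 false
    have h5 : 0 ≤ Real.pi * M := by positivity
    have h6 : 0 ≤ Real.pi * M * (‖f true‖ ^ 2 + ‖f false‖ ^ 2) := by positivity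
    linarith

end


/-! ### Fredholm properties under finitely many linear constraints -/

section Fredholm

variable {H : Type*} [NormedAddCommGroup H] [InnerProductSpace ℂ H]

theorem shift_apply (T : H →ₗ.[ℂ] H) (z : ℂ) (x : T.domain) :
    shift T z x = T x - z • (x : H) := rfl

/-- A bounded operator on a Hilbert space whose range has finite codimension has closed range. -/
theorem isClosed_range_of_cofg [CompleteSpace H] (B : H →L[ℂ] H)
    (h : (LinearMap.range (B : H →ₗ[ℂ] H)).CoFG) :
    IsClosed (LinearMap.range (B : H →ₗ[ℂ] H) : Set H) := by
  set N : Submodule ℂ H := LinearMap.ker (B : H →ₗ[ℂ] H) with hN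
  have hNc : IsClosed (N : Set H) := B.isClosed_ker
  have : CompleteSpace N := hNc.completeSpace_coe
  -- Restricting to the orthogonal complement of the kernel gives an injective operator with the
  -- same range, and a complement of that range is finite-dimensional, hence closed.
  let B' : Nᗮ →L[ℂ] H := B.comp Nᗮ.subtypeL
  have hr : LinearMap.range (B' : Nᗮ →ₗ[ℂ] H) = LinearMap.range (B : H →ₗ[ℂ] H) := by
    apply le_antisymm
    · rintro _ ⟨x, rfl⟩
      exact ⟨x, rfl⟩
    · rintro _ ⟨x, rfl⟩
      obtain ⟨y, hy, z, hz, rfl⟩ := N.exists_add_mem_mem_orthogonal x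
      refine ⟨⟨z, hz⟩, ?_⟩
      have : B y = 0 := hy
      simp [B', this]
  have hk : LinearMap.ker (B' : Nᗮ →ₗ[ℂ] H) = ⊥ := by
    rw [LinearMap.ker_eq_bot']
    rintro ⟨x, hx⟩ h0
    have : x ∈ N := h0
    have h1 := Submodule.inner_right_of_mem_orthogonal this hx
    exact Subtype.ext (inner_self_eq_zero.1 h1)
  obtain ⟨G, hG⟩ := Submodule.exists_isCompl (LinearMap.range (B' : Nᗮ →ₗ[ℂ] H))
  have hGf : FiniteDimensional ℂ G :=
    .of_fg (Submodule.CoFG.fg_of_isCompl hG (by rw [hr]; exact h))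
  rw [← hr]
  exact B'.closed_complemented_range_of_isCompl_of_ker_eq_bot G hG
    G.closed_of_finiteDimensional hk

/-- Writing `x = R y` gives `(T - z) x = y + (e - z) R y`. The range of the unbounded operator is
thus that of a bounded one. -/
theorem range_shift_eq {T : H →ₗ.[ℂ] H} {e : ℂ} {R : H →L[ℂ] H}
    (h1 : ∀ x : T.domain, R (shift T e x) = (x : H))
    (h2 : ∀ y : H, ∃ h : R y ∈ T.domain, shift T e ⟨R y, h⟩ = y) (z : ℂ) :
    LinearMap.range (shift T z) =
      LinearMap.range ((ContinuousLinearMap.id ℂ H + (e - z) • R : H →L[ℂ] H) : H →ₗ[ℂ] H) := by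
  apply le_antisymm
  · rintro _ ⟨x, rfl⟩
    refine ⟨shift T e x, ?_⟩
    simp only [ContinuousLinearMap.coe_coe, add_apply, ContinuousLinearMap.id_apply, smul_apply,
      h1 x]
    simp only [shift_apply]
    module
  · rintro _ ⟨y, rfl⟩
    obtain ⟨h, hy⟩ := h2 y
    refine ⟨⟨R y, h⟩, ?_⟩
    simp only [ContinuousLinearMap.coe_coe, add_apply,
      ContinuousLinearMap.id_apply, smul_apply]
    nth_rw 2 [← hy]
    simp only [shift_apply]
    module

/-- An operator with a resolvent point has closed range as soon as the range has finite
codimension. -/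
theorem isClosed_range_shift [CompleteSpace H] {T : H →ₗ.[ℂ] H} {e : ℂ}
    (he : IsResolventPoint T e) {z : ℂ} (h : (LinearMap.range (shift T z)).CoFG) :
    IsClosed (LinearMap.range (shift T z) : Set H) := by
  obtain ⟨R, h1, h2⟩ := he
  rw [range_shift_eq h1 h2] at h ⊢
  exact isClosed_range_of_cofg _ h

/-- Fredholmness is inherited by an operator that has a resolvent point and agrees with the given
one up to finitely many linear constraints. -/
theorem IsFredholmAt.of_agree_on_ker [CompleteSpace H] {T T' : H →ₗ.[ℂ] H} {e z : ℂ}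
    (he : IsResolventPoint T' e) {V : Type*} [AddCommGroup V] [Module ℂ V]
    [FiniteDimensional ℂ V] (Φ : H × H →ₗ[ℂ] V)
    (hG : ∀ p, Φ p = 0 → (p ∈ T.graph ↔ p ∈ T'.graph)) (h : IsFredholmAt T z) :
    IsFredholmAt T' z := by
  have hcofg : (LinearMap.range (shift T' z)).CoFG := by
    let Ψ : T.domain →ₗ[ℂ] V := Φ.comp (T.domain.subtype.prod T.toFun)
    -- The constraints cut the domain by finitely many dimensions, so the image of what remains
    -- still has finite codimension; it lies in the range of `T' - z`.
    have h1 : ((LinearMap.ker Ψ).map (shift T z)).CoFG := by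
      obtain ⟨W, hW⟩ := Submodule.exists_isCompl (LinearMap.ker Ψ)
      obtain ⟨X, hX⟩ := Submodule.exists_isCompl (LinearMap.range (shift T z))
      have hWf : W.FG := Submodule.CoFG.fg_of_isCompl hW (Submodule.CoFG.ker Ψ)
      have hXf : X.FG := Submodule.CoFG.fg_of_isCompl hX h.finiteDimensional_coker
      refine Submodule.FG.cofg_of_codisjoint (S := W.map (shift T z) ⊔ X) ?_
        ((hWf.map _).sup hXf)
      rw [codisjoint_iff, sup_right_comm, ← Submodule.map_sup, sup_comm W, hW.sup_eq_top,
        Submodule.map_top, hX.sup_eq_top]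
    refine Submodule.CoFG.of_le ?_ h1
    rintro _ ⟨x, hx, rfl⟩
    have hx' : Φ ((x : H), T x) = 0 := hx
    have := (hG _ hx').1 (T.mem_graph x)
    rw [LinearPMap.mem_graph_iff] at this
    obtain ⟨y, hy1, hy2⟩ := this
    refine ⟨y, ?_⟩
    simp only at hy1 hy2
    rw [shift_apply, shift_apply, hy1, hy2]
  refine ⟨?_, isClosed_range_shift he hcofg, hcofg⟩
  -- The constrained part of this kernel embeds into the kernel of `T - z`, and the constraints
  -- remove only finitely many dimensions.
  let Ψ : LinearMap.ker (shift T' z) →ₗ[ℂ] V :=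
    Φ.comp ((T'.domain.subtype.prod T'.toFun).comp (LinearMap.ker (shift T' z)).subtype)
  let K : Submodule ℂ H := (LinearMap.ker (shift T z)).map T.domain.subtype
  have := h.finiteDimensional_ker
  have hm : ∀ x : LinearMap.ker Ψ, ((x : LinearMap.ker (shift T' z)) : H) ∈ K := by
    rintro ⟨⟨x, hx⟩, hx'⟩
    have h0 : Φ ((x : H), T' x) = 0 := hx'
    have h1 := (hG _ h0).2 (T'.mem_graph x)
    rw [LinearPMap.mem_graph_iff] at h1
    obtain ⟨y, hy1, hy2⟩ := h1
    refine ⟨y, ?_, hy1⟩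
    have h2 : T' x - z • (x : H) = 0 := hx
    change T y - z • (y : H) = 0
    simp only at hy1 hy2
    rw [hy1, hy2, h2]
  let j : LinearMap.ker Ψ →ₗ[ℂ] K := LinearMap.codRestrict K
    (T'.domain.subtype.comp ((LinearMap.ker (shift T' z)).subtype.comp (LinearMap.ker Ψ).subtype))
    hm
  have hj : Function.Injective j := by
    intro x y hxy
    have := congrArg (fun k : K => (k : H)) hxy
    exact Subtype.ext (Subtype.ext (Subtype.ext this))
  have : FiniteDimensional ℂ (LinearMap.ker Ψ) := FiniteDimensional.of_injective j hj
  have : FiniteDimensional ℂ (LinearMap.ker (shift T' z) ⧸ LinearMap.ker Ψ) :=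
    Submodule.CoFG.ker Ψ
  exact Module.Finite.of_submodule_quotient (LinearMap.ker Ψ)

end Fredholm

/-! ### Resolvent points -/

theorem isResolventPoint_of_bound {H : Type*} [NormedAddCommGroup H] [InnerProductSpace ℂ H]
    {T : H →ₗ.[ℂ] H} {z : ℂ} {K : ℝ} (hinj : ∀ x : T.domain, shift T z x = 0 → (x : H) = 0)
    (hsurj : ∀ y : H, ∃ x : T.domain, shift T z x = y ∧ ‖(x : H)‖ ≤ K * ‖y‖) :
    IsResolventPoint T z := by
  have hb : Function.Bijective (shift T z) := by
    refine ⟨?_, fun y => (hsurj y).imp fun x hx => hx.1⟩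
    rw [← LinearMap.ker_eq_bot, LinearMap.ker_eq_bot']
    exact fun x hx => Subtype.ext (hinj x hx)
  let e := LinearEquiv.ofBijective (shift T z) hb
  let R₀ : H →ₗ[ℂ] H := T.domain.subtype.comp (e.symm : H →ₗ[ℂ] T.domain)
  have hR₀ : ∀ y, ‖R₀ y‖ ≤ K * ‖y‖ := fun y => by
    obtain ⟨x, rfl, hx⟩ := hsurj y
    have : e.symm (shift T z x) = x := e.symm_apply_apply x
    change ‖((e.symm (shift T z x) : T.domain) : H)‖ ≤ _
    rwa [this]
  refine ⟨R₀.mkContinuous K hR₀, fun x => ?_, fun y => ⟨(e.symm y).2, ?_⟩⟩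
  · exact congrArg Subtype.val (e.symm_apply_apply x)
  · exact e.apply_symm_apply y

theorem exists_of_mem_hamiltonianGraph {A : ℝ} {β : ℤ → ℝ} {p : L2Chain × L2Chain}
    (hp : p ∈ hamiltonianGraph A β) :
    ∃ x : (hamiltonian A β).domain, (x : L2Chain) = p.1 ∧ hamiltonian A β x = p.2 := by
  rw [← hamiltonian_graph, LinearPMap.mem_graph_iff] at hp
  exact hp

theorem mem_hamiltonianGraph {A : ℝ} {β : ℤ → ℝ} (x : (hamiltonian A β).domain) :
    ∃ u v w, IsWaveFunction A β (x : L2Chain) (hamiltonian A β x) u v w := by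
  have := (hamiltonian A β).mem_graph x
  rw [hamiltonian_graph] at this
  exact this

theorem source_zero (A E : ℝ) (j : ℤ) : source A E (fun s => ((0 : L2Chain) s : ℝ → ℂ)) j = 0 := by
  have h (s : Bool) {κ : ℝ → ℝ} (hκ : Continuous κ) (j : ℤ) :
      edgeInt A s κ j ((0 : L2Chain) s : ℝ → ℂ) = 0 := (edgeIntL A s hκ j).map_zero
  have hc := continuous_sinE E
  have hc' : Continuous fun t => sinE E (Real.pi - t) := by fun_prop
  simp only [source, h _ hc, h _ hc', mul_zero, add_zero]

/-- Unique solvability of the diagonally dominant Jacobi equation is lifted to the chain: uniqueness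
through the vertex values, existence with a norm bound through `exists_wave`. -/
theorem isResolventPoint_hamiltonian {A E D : ℝ} {β : ℤ → ℝ} (hE : E < 1)
    (hD : 2 * |2 * Real.cos (A * Real.pi)| < D) (hβ : ∀ j, D ≤ disc (β j) E) :
    IsResolventPoint (hamiltonian A β) (E : ℂ) := by
  have hS := (sinE_pi_pos hE).ne'
  obtain ⟨M, hM, hwave⟩ := exists_wave hS
  obtain ⟨K, hK, hsrc⟩ := exists_source_bound E
  set k := (1 / (D - 2 * |2 * Real.cos (A * Real.pi)|)) ^ 2 with hk
  have hk0 : 0 ≤ k := by positivity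
  refine isResolventPoint_of_bound (K := √(M * (k * K + 1))) (fun x hx => ?_) fun f => ?_
  · obtain ⟨u, v, w, h⟩ := mem_hamiltonianGraph x
    have hη : hamiltonian A β x = (E : ℂ) • (x : L2Chain) := sub_eq_zero.1 hx
    refine h.eq_zero hS hη fun j => ?_
    refine jacobi_eq_zero hD hβ (q := fun j => u true j (j * Real.pi)) ?_ (fun j => ?_) j
    · simp only [h.trace]
      exact summable_trace A _
    · have := h.jacobi E j
      rw [hη, sub_self, source_zero] at this
      exact this
  · obtain ⟨hs, hle⟩ := hsrc A f
    obtain ⟨q, hq, hqle, hjac⟩ := exists_jacobi_solution hD hβ hs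
    obtain ⟨ψ, u, v, w, h, -, hψ⟩ := hwave A β f q hq hjac
    obtain ⟨x, hx1, hx2⟩ := exists_of_mem_hamiltonianGraph
      (show (ψ, f + (E : ℂ) • ψ) ∈ hamiltonianGraph A β from ⟨u, v, w, h⟩)
    refine ⟨x, ?_, ?_⟩
    · rw [shift_apply, hx1, hx2, add_sub_cancel_right]
    · rw [hx1]
      refine le_of_sq_le_sq ?_ (by positivity)
      rw [mul_pow, Real.sq_sqrt (by positivity)]
      calc ‖ψ‖ ^ 2 ≤ M * (∑' j, ‖q j‖ ^ 2 + ‖f‖ ^ 2) := hψ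
        _ ≤ M * (k * (K * ‖f‖ ^ 2) + ‖f‖ ^ 2) := by
            gcongr
            exact hqle.trans (by gcongr)
        _ = _ := by ring

theorem two_mul_abs_le (x : ℝ) : 2 * |2 * Real.cos x| ≤ 4 := by
  rw [abs_mul, abs_two]
  linarith [Real.abs_cos_le_one x]

/-- Couplings bounded below give, at very low energy, diagonal entries at least `5`, above `2 * |c|
≤ 4`. This supplies the resolvent point that the Fredholm argument requires. -/
theorem exists_isResolventPoint {A B : ℝ} {β : ℤ → ℝ} (hβ : ∀ j, B ≤ β j) :
    ∃ E : ℝ, IsResolventPoint (hamiltonian A β) (E : ℂ) := by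
  obtain ⟨E₀, hE₀, h⟩ := exists_le_disc B
  exact ⟨E₀, isResolventPoint_hamiltonian (by linarith)
    ((two_mul_abs_le _).trans_lt (by norm_num)) fun j =>
      (h E₀ le_rfl).trans (disc_mono (by linarith) (hβ j))⟩

/-! ### The band edge belongs to the spectrum -/

/-- A function on one semicircle of ring `0` reaches only the vertices `0` and `1`. Taking the
integral kernel itself, with the inverse gauge, makes the source at `0` the integral of a positive
square. -/
theorem exists_source_ne_zero (A : ℝ) {E : ℝ} (hE : E < 1) :
    ∃ f : L2Chain, (∀ j, j ≠ 0 → j ≠ 1 → source A E (fun s => f s) j = 0) ∧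
      source A E (fun s => f s) 0 ≠ 0 := by
  have hc := continuous_sinE E
  let g : ℝ → ℂ := (edge 0).indicator fun x =>
    gauge (-coeff A true) ((0 : ℤ) * Real.pi) x * (sinE E (Real.pi - (x - (0 : ℤ) * Real.pi)) : ℂ)
  have hgc : Continuous fun x =>
      gauge (-coeff A true) ((0 : ℤ) * Real.pi) x * (sinE E (Real.pi - (x - (0 : ℤ) * Real.pi)) : ℂ) := by
    have := continuous_gauge (-coeff A true) ((0 : ℤ) * Real.pi)
    fun_prop
  have hg : MemLp g 2 volume := by
    rw [memLp_indicator_iff_restrict (measurableSet_edge 0)]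
    exact memLp_of_continuousOn hgc.continuousOn
  let f : L2Chain := WithLp.toLp 2 fun s => if s then hg.toLp else 0
  have hft : ∀ j, ∀ᵐ x ∂(volume.restrict (edge j)), (f true : ℝ → ℂ) x = g x := fun j =>
    ae_restrict_of_ae hg.coeFn_toLp
  have hff : ∀ κ : ℝ → ℝ, ∀ j, edgeInt A false κ j (f false) = 0 := fun κ j => by
    refine integral_eq_zero_of_ae ?_
    filter_upwards [ae_restrict_of_ae (Lp.coeFn_zero ℂ 2 (volume : Measure ℝ))] with x hx
    have : (f false : ℝ → ℂ) x = 0 := hx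
    rw [this]; simp
  have ht : ∀ κ : ℝ → ℝ, ∀ j, j ≠ 0 → edgeInt A true κ j (f true) = 0 := fun κ j hj => by
    refine integral_eq_zero_of_ae ?_
    filter_upwards [hft j, ae_restrict_mem (measurableSet_edge j)] with x hx hxj
    have : x ∉ edge 0 := fun h0 => Set.disjoint_left.1 (pairwise_disjoint_edge hj) hxj h0
    rw [hx]
    simp [g, this]
  refine ⟨f, fun j h0 h1 => ?_, ?_⟩
  · simp only [source, hff, ht _ j h0, ht _ (j - 1) (sub_ne_zero.2 h1), mul_zero, add_zero]
  · simp only [source, hff, ht _ (0 - 1) (by norm_num), mul_zero, add_zero]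
    rw [edgeInt_congr (hft 0)]
    have h1 : edgeInt A true (fun t => sinE E (Real.pi - t)) 0 g =
        ((∫ x in edge 0, sinE E (Real.pi - (x - (0 : ℤ) * Real.pi)) ^ 2 : ℝ) : ℂ) := by
      rw [← integral_complex_ofReal]
      refine setIntegral_congr_fun (measurableSet_edge 0) fun x hx => ?_
      simp only [g, Set.indicator_of_mem hx]
      rw [Complex.ofReal_pow]
      linear_combination (sinE E (Real.pi - (x - (0 : ℤ) * Real.pi)) : ℂ) ^ 2 *
        gauge_neg_mul (coeff A true) ((0 : ℤ) * Real.pi) x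
    rw [h1]
    refine Complex.ofReal_ne_zero.2 (ne_of_gt ?_)
    rw [edge, ← integral_Ioc_eq_integral_Ioo, ← intervalIntegral.integral_of_le (edge_lt 0).le]
    refine intervalIntegral.intervalIntegral_pos_of_pos_on
      (Continuous.intervalIntegrable (by fun_prop) _ _) (fun x hx => ?_) (edge_lt 0)
    have h2 := hx.1
    have h3 := hx.2
    push_cast at h2 h3 ⊢
    exact pow_pos (sinE_pos hE (by linarith) (by linarith)) 2

/-- If `b` were a resolvent point, solving for the function of `exists_source_ne_zero` would yield
`ℓ²` vertex values, contradicting `jacobi_bandEdge_eq_zero`. -/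
theorem bandEdge_mem_spectrum {A α b : ℝ} (hb1 : b < 1)
    (hb : disc α b = 2 * |2 * Real.cos (A * Real.pi)|) :
    (b : ℂ) ∈ spectrum (hamiltonian A fun _ => α) := by
  rintro ⟨R, -, hR⟩
  obtain ⟨f, hf, hf0⟩ := exists_source_ne_zero A hb1
  obtain ⟨hd, hx⟩ := hR f
  obtain ⟨u, v, w, h⟩ := mem_hamiltonianGraph ⟨R f, hd⟩
  rw [shift_apply] at hx
  refine hf0 (jacobi_bandEdge_eq_zero (c := 2 * Real.cos (A * Real.pi))
    (q := fun j => u true j (j * Real.pi)) (r := source A b fun s => f s) ?_ hf fun j => ?_)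
  · simp only [h.trace]
    exact summable_trace A _
  · have := h.jacobi b j
    rw [hx, hb] at this
    exact this

/-! ### Invariance of the essential spectrum -/

/-- The coupling enters only multiplied by the vertex value, so it is invisible where that value
vanishes. -/
theorem mem_hamiltonianGraph_of_trace_eq_zero {A : ℝ} {β β' : ℤ → ℝ} {p : L2Chain × L2Chain}
    (h : ∀ j, β j ≠ β' j → traceMap A j p = 0) (hp : p ∈ hamiltonianGraph A β) :
    p ∈ hamiltonianGraph A β' := by
  obtain ⟨u, v, w, hw⟩ := hp
  refine ⟨u, v, w, hw.sobolev, hw.ae_eq, hw.action, hw.cont_lower, hw.cont_left, fun j => ?_⟩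
  rw [hw.delta j]
  by_cases hj : β j = β' j
  · rw [hj]
  · rw [hw.trace j, h j hj, mul_zero, mul_zero]

theorem isFredholmAt_hamiltonian_congr {A B : ℝ} {β β' : ℤ → ℝ} {S : Finset ℤ}
    (hS : ∀ j ∉ S, β j = β' j) (hβ' : ∀ j, B ≤ β' j) {z : ℂ}
    (h : IsFredholmAt (hamiltonian A β) z) : IsFredholmAt (hamiltonian A β') z := by
  obtain ⟨E, hE⟩ := exists_isResolventPoint (A := A) hβ'
  refine h.of_agree_on_ker hE (LinearMap.pi fun j : S => traceMap A (j : ℤ)) fun p hp => ?_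
  have hp' : ∀ j, β j ≠ β' j → traceMap A j p = 0 := fun j hj => by
    by_cases hjS : j ∈ S
    · exact congrFun hp ⟨j, hjS⟩
    · exact absurd (hS j hjS) hj
  rw [hamiltonian_graph, hamiltonian_graph]
  exact ⟨mem_hamiltonianGraph_of_trace_eq_zero hp',
    mem_hamiltonianGraph_of_trace_eq_zero fun j hj => hp' j hj.symm⟩

theorem exists_le_perturbedCoupling (α : ℝ) (m : ℕ) (γ : ℤ → ℝ) :
    ∃ B, ∀ j, B ≤ perturbedCoupling α m γ j := by
  refine ⟨α - ∑ i ∈ Finset.Icc (1 : ℤ) m, |γ i|, fun j => ?_⟩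
  have h0 : 0 ≤ ∑ i ∈ Finset.Icc (1 : ℤ) m, |γ i| := Finset.sum_nonneg fun i _ => abs_nonneg _
  rw [perturbedCoupling]
  split_ifs with hj
  · have := Finset.single_le_sum (f := fun i => |γ i|) (fun i _ => abs_nonneg _)
      (Finset.mem_Icc.2 hj)
    linarith [neg_abs_le (γ j)]
  · linarith

theorem essSpectrum_perturbed (A α : ℝ) (m : ℕ) (γ : ℤ → ℝ) :
    essSpectrum (hamiltonian A (perturbedCoupling α m γ)) =
      essSpectrum (hamiltonian A fun _ => α) := by
  have hS : ∀ j ∉ Finset.Icc (1 : ℤ) m, perturbedCoupling α m γ j = α := fun j hj => by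
    rw [perturbedCoupling, if_neg (by simpa using hj)]
  obtain ⟨B, hB⟩ := exists_le_perturbedCoupling α m γ
  ext z
  exact not_congr ⟨isFredholmAt_hamiltonian_congr hS fun _ => le_rfl,
    isFredholmAt_hamiltonian_congr (fun j hj => (hS j hj).symm) hB⟩

end

end RingChain

/-! ### The main theorem -/

theorem mainTheorem8 (A α : ℝ) (m : ℕ) (hm : 1 ≤ m) (γ : ℤ → ℝ) :
    RingChain.essSpectrum (RingChain.hamiltonian A (RingChain.perturbedCoupling α m γ)) =
        RingChain.essSpectrum (RingChain.hamiltonian A (fun _ => α)) ∧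
      ∀ g : ℝ, g < 0 → (∀ j : ℤ, 1 ≤ j → j ≤ m → γ j = g) →
        ∃ b E : ℝ,
          IsLeast {s : ℝ | (s : ℂ) ∈ RingChain.spectrum (RingChain.hamiltonian A (fun _ => α))} b ∧
          E < b ∧
          RingChain.IsEigenvalue
            (RingChain.hamiltonian A (RingChain.perturbedCoupling α m γ)) (E : ℂ) := by
  open RingChain in
  refine ⟨essSpectrum_perturbed A α m γ, fun g hg hγ => ?_⟩
  have hc := two_mul_abs_le (A * Real.pi)
  obtain ⟨b, hb1, hb, hlt⟩ := exists_bandEdge α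
    (show 0 ≤ 2 * |2 * Real.cos (A * Real.pi)| by positivity) (by linarith)
  obtain ⟨E, hE, q, ⟨i, hi⟩, hq, hjac⟩ :=
    exists_bound_state (by linarith) hg hb1 hb hlt hm
  refine ⟨b, E, ⟨bandEdge_mem_spectrum hb1 hb, fun s hs => ?_⟩, hE, ?_⟩
  · by_contra! hsb
    exact hs (isResolventPoint_hamiltonian (hsb.trans hb1) (hlt s hsb) fun _ => le_rfl)
  obtain ⟨M, -, hwave⟩ := exists_wave (sinE_pi_pos (hE.trans hb1)).ne'
  obtain ⟨ψ, u, v, w, h, hu, -⟩ := hwave A (perturbedCoupling α m γ) 0 (fun j => (q j : ℂ))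
    (by simpa using hq) (fun j => by
      have h1 := hjac j
      have h2 : perturbedCoupling α m γ j = if 1 ≤ j ∧ j ≤ m then α + g else α := by
        rw [perturbedCoupling]
        split_ifs with hj
        · rw [hγ j hj.1 hj.2]
        · rfl
      rw [source_zero, h2, sub_eq_zero]
      exact_mod_cast h1)
  rw [zero_add] at h
  obtain ⟨x, hx1, hx2⟩ := exists_of_mem_hamiltonianGraph
    (show (ψ, (E : ℂ) • ψ) ∈ hamiltonianGraph A (perturbedCoupling α m γ) from ⟨u, v, w, h⟩)
  refine ⟨x, fun h0 => hi ?_, by rw [hx2, hx1]⟩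
  -- A zero function would have zero vertex values, but `q i ≠ 0`.
  have h3 : ψ = 0 := hx1.symm.trans h0
  have h4 := h.trace i
  rw [h3, smul_zero, show ((0 : L2Chain), (0 : L2Chain)) = 0 from rfl, map_zero, hu] at h4
  exact_mod_cast h4
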